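/- **Setting.** Let $d\ge 1$, let $S^{d-1}\subset\mathbb R^d$ be the unit sphere with its surface measure $d\omega$, and let $A(r)$ be the surface area of the sphere of radius $r$ in $\mathbb R^d$. Let $p$ be a density on $[0,\infty)$, i.e. $p\ge 0$ is measurable and $\int_0^\infty p(r)\,dr<\infty$, such that $0<\int_0^\infty p(r)r^2\,dr<\infty$. Let $\nu$ be the measure on $\mathbb R^d$ with Lebesgue density $\bar p(x)=p(\|x\|)/A(\|x\|)$, and put $M_q=\int_0^\infty \frac{r^{q+d-1}p(r)}{A(r)}\,dr$ for $q=0,1,2$. For $x\neq 0$ write $r_x=\|x\|$ and $\hat x=x/\|x\|$. A kernel $K$ is *homogeneous of order* $\alpha$ with profile $\hat K$ if $K(x,z)=r_x^\alpha r_z^\alpha\,\hat K(\hat x^T\hat z)$ for all nonzero $x,z\in\mathbb R^d$, where $\hat K:[-1,1]\to\mathbb R$ is measurable and bounded (boundedness is automatic for positive definite kernels, positive definiteness is not needed). An *eigenfunction* of $K$ with eigenvalue $c$ is an $f\in L^2(\nu)$, not $\nu$-a.e. zero, with $\int K(x,z)f(z)\,d\nu(z)=c f(x)$ for $\nu$-a.e.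 $x$. A *spherical harmonic of degree $k$* is the restriction to $S^{d-1}$ of a harmonic homogeneous polynomial of degree $k$; $N(d,k)$ is the dimension of the space of these, and $(Y_{k,j})_{1\le j\le N(d,k)}$ denotes an arbitrary basis of it that is orthonormal in $L^2(S^{d-1},d\omega)$. **Theorem.** Let $k_0$ be homogeneous of order $1$ with profile $\hat k_0$, and $k_1$ homogeneous of order $0$ with profile $\hat k_1$. There are real sequences $(\lambda_k)_{k\ge0},(\mu_k)_{k\ge0}$ such that for every spherical harmonic $Y$ of degree $k$ and every $\omega\in S^{d-1}$ $$\int_{S^{d-1}}\hat k_0(\omega^T\eta)Y(\eta)\,d\eta=\lambda_kY(\omega),\qquad \int_{S^{d-1}}\hat k_1(\omega^T\eta)Y(\eta)\,d\eta=\mu_kY(\omega),$$ and the following holds (all integrals converging absolutely). 1. *Order 1.* For every spherical harmonic $Y$ of degree $k$ and $a\in\mathbb R$, the function $\Psi(x)=a\,r_xY(\hat x)$ satisfies $\int k_0(x,z)\Psi(z)\,d\nu(z)=M_2\lambda_k\Psi(x)$ for all $x\ne0$. Moreover $M_2>0$, and if $a^2=M_2^{-1}$, then the functions $\Psi_{k,j}(x)=a\,r_xY_{k,j}(\hat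 x)$ are orthonormal in $L^2(\nu)$ and are eigenfunctions of $k_0$ with eigenvalues $M_2\lambda_k$, and every eigenfunction of $k_0$ with eigenvalue $c\neq0$ is $\nu$-a.e. equal to a finite linear combination of those $\Psi_{k,j}$ for which $M_2\lambda_k=c$. 2. *Sum of order 1 and order 0.* For every $k\ge 0$, every spherical harmonic $Y$ of degree $k$ and all $\alpha,\beta\in\mathbb R$, for all $x\neq0$, $$\int (k_0+k_1)(x,z)\,(\alpha r_z+\beta)Y(\hat z)\,d\nu(z)=(a r_x+b)\,Y(\hat x),\qquad \begin{pmatrix}a\\ b\end{pmatrix}=B_k\begin{pmatrix}\alpha\\ \beta\end{pmatrix},\quad B_k=\begin{pmatrix}\lambda_k&0\\0&\mu_k\end{pmatrix}\begin{pmatrix}M_2&M_1\\M_1&M_0\end{pmatrix},$$ so the span of $r_xY(\hat x)$ and $Y(\hat x)$ is invariant. Moreover, for each $k$ there are $(a_{k,s},b_{k,s})\in\mathbb R^2$ and $\rho_{k,s}\in\mathbb R$, $s=1,2$, not depending on the choice of the $Y_{k,j}$, with $B_k(a_{k,s},b_{k,s})^T=\rho_{k,s}(a_{k,s},b_{k,s})^T$,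 such that the functions $\Psi_{k,j,s}(x)=(a_{k,s}r_x+b_{k,s})Y_{k,j}(\hat x)$ are orthonormal in $L^2(\nu)$ and are eigenfunctions of $k_0+k_1$ with eigenvalues $\rho_{k,s}$, and every eigenfunction of $k_0+k_1$ with eigenvalue $c\ne0$ is $\nu$-a.e. equal to a finite linear combination of those $\Psi_{k,j,s}$ for which $\rho_{k,s}=c$. -/

import Mathlib

open MeasureTheory Set

noncomputable section

/-- The space `ℝ^d` with its Euclidean norm. -/
abbrev Eucl (d : ℕ) : Type := EuclideanSpace ℝ (Fin d)

/-- The unit sphere `S^{d-1}` of `ℝ^d`. -/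
abbrev USphere (d : ℕ) : Type := Metric.sphere (0 : Eucl d) 1

/-- The (unnormalized) surface measure of the unit sphere `S^{d-1}`. -/
def surfMeasure (d : ℕ) : Measure (USphere d) := (volume : Measure (Eucl d)).toSphere

/-- `A(r)`, the surface area of the sphere of radius `r` in `ℝ^d`. -/
def sphereArea (d : ℕ) (r : ℝ) : ℝ := r ^ (d - 1) * (surfMeasure d).real univ

/-! ### Spherical harmonics -/

/-- The Laplacian on polynomials in `d` real variables. -/
def polyLaplacian (d : ℕ) : MvPolynomial (Fin d) ℝ →ₗ[ℝ] MvPolynomial (Fin d) ℝ :=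
  ∑ i : Fin d, (MvPolynomial.pderiv (R := ℝ) i).toLinearMap ∘ₗ
    (MvPolynomial.pderiv (R := ℝ) i).toLinearMap

/-- Restriction of a polynomial to the unit sphere. -/
def restrictToSphere (d : ℕ) : MvPolynomial (Fin d) ℝ →ₗ[ℝ] (USphere d → ℝ) where
  toFun P := fun x => MvPolynomial.eval (fun i => (x : Eucl d) i) P
  map_add' P Q := by ext x; simp
  map_smul' c P := by ext x; simp

/-- The space of spherical harmonics of degree `k` on `S^{d-1}`: restrictions to the sphere of the
harmonic homogeneous polynomials of degree `k`. -/
def sphericalHarmonics (d k : ℕ) : Submodule ℝ (USphere d → ℝ) :=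
  (MvPolynomial.homogeneousSubmodule (Fin d) ℝ k ⊓ LinearMap.ker (polyLaplacian d)).map
    (restrictToSphere d)

/-- `N(d,k)`, the dimension of the space of spherical harmonics of degree `k`. -/
def numHarmonics (d k : ℕ) : ℕ := Module.finrank ℝ (sphericalHarmonics d k)

/-- `Y k j`, `j < N(d,k)`, is for each degree `k` an `L²(S^{d-1})`-orthonormal basis of the space of
spherical harmonics of degree `k`. -/
structure IsHarmonicBasis (d : ℕ) (Y : (k : ℕ) → Fin (numHarmonics d k) → USphere d → ℝ) :
    Prop where
  span_eq : ∀ k, Submodule.span ℝ (range (Y k)) = sphericalHarmonics d k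
  orthonormal : ∀ k i j,
    ∫ ω, Y k i ω * Y k j ω ∂(surfMeasure d) = if i = j then 1 else 0

/-! ### Radial densities -/

/-- A density `p` on `[0,∞)` (nonnegative and integrable) with `0 < ∫ p(r) r² dr < ∞`. -/
structure IsRadialDensity (p : ℝ → ℝ) : Prop where
  measurable : Measurable p
  nonneg : ∀ r, 0 ≤ r → 0 ≤ p r
  integrable : IntegrableOn p (Ioi 0)
  integrable_sq : IntegrableOn (fun r => p r * r ^ 2) (Ioi 0)
  pos_sq : 0 < ∫ r in Ioi 0, p r * r ^ 2

/-- The rotation-invariant measure on `ℝ^d` with Lebesgue density `p(‖x‖) / A(‖x‖)`, under which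
the norm has density `p`. -/
def radialMeasure (d : ℕ) (p : ℝ → ℝ) : Measure (Eucl d) :=
  volume.withDensity fun x => ENNReal.ofReal (p ‖x‖ / sphereArea d ‖x‖)

/-- The moment `M_q = ∫₀^∞ r^{q+d-1} p(r) / A(r) dr`. -/
def radialMoment (d : ℕ) (p : ℝ → ℝ) (q : ℕ) : ℝ :=
  ∫ r in Ioi (0 : ℝ), r ^ (q + d - 1) * p r / sphereArea d r

/-! ### Kernels -/

/-- `k` is homogeneous of order `α` with angular profile `κ` (a bounded measurable function on
`[-1,1]`): `k(x,z) = ‖x‖^α ‖z‖^α κ(xᵀz / (‖x‖ ‖z‖))` for all nonzero `x`, `z`. -/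
structure IsHomogeneousKernel {d : ℕ} (α : ℝ) (k : Eucl d → Eucl d → ℝ) (κ : ℝ → ℝ) : Prop where
  measurable : Measurable fun t : Icc (-1 : ℝ) 1 => κ t
  bounded : ∃ C, ∀ t ∈ Icc (-1 : ℝ) 1, |κ t| ≤ C
  eq : ∀ x z, x ≠ 0 → z ≠ 0 →
    k x z = ‖x‖ ^ α * ‖z‖ ^ α * κ (inner ℝ x z / (‖x‖ * ‖z‖))

/-- `f ∈ L²(ν)`, not a.e. zero, is an eigenfunction with eigenvalue `c` of the kernel `k` with
respect to the measure `ν`: `∫ k(x,z) f(z) dν(z) = c f(x)` for `ν`-almost every `x`. -/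
structure IsKernelEigenfunction {d : ℕ} (ν : Measure (Eucl d)) (k : Eucl d → Eucl d → ℝ)
    (c : ℝ) (f : Eucl d → ℝ) : Prop where
  memLp : MemLp f 2 ν
  ne_zero : ¬ f =ᵐ[ν] 0
  eigen : ∀ᵐ x ∂ν, Integrable (fun z => k x z * f z) ν ∧ ∫ z, k x z * f z ∂ν = c * f x

/-- An orthonormal system of functions in `L²(ν)`. -/
structure IsOrthonormalSystem {d : ℕ} {ι : Type} (ν : Measure (Eucl d)) (Φ : ι → Eucl d → ℝ) :
    Prop where
  memLp : ∀ i, MemLp (Φ i) 2 ν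
  norm_eq_one : ∀ i, ∫ x, Φ i x * Φ i x ∂ν = 1
  orthogonal : ∀ i j, i ≠ j → ∫ x, Φ i x * Φ j x ∂ν = 0

/-- The function `x ↦ (v₀ ‖x‖ + v₁) Y(x / ‖x‖)` on `ℝ^d \ {0}` (extended by zero to the origin). -/
def affineHarmonic {d : ℕ} (v : Fin 2 → ℝ) (Y : USphere d → ℝ) (x : Eucl d) : ℝ :=
  if hx : x = 0 then 0
  else (v 0 * ‖x‖ + v 1) * Y ⟨‖x‖⁻¹ • x, by simp [norm_smul, hx]⟩

/-- The eigenvalue relation on the sphere: for each `k`, every spherical harmonic `Y` of degree `k`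
satisfies `∫ κ(ωᵀη) Y(η) dη = lam_k Y(ω)` for all `ω ∈ S^{d-1}`. -/
def HasSphereEigenvalues (d : ℕ) (κ : ℝ → ℝ) (lam : ℕ → ℝ) : Prop :=
  ∀ k, ∀ Y ∈ sphericalHarmonics d k, ∀ ω : USphere d,
    Integrable (fun η : USphere d => κ (inner ℝ (ω : Eucl d) (η : Eucl d)) * Y η) (surfMeasure d) ∧
    ∫ η : USphere d, κ (inner ℝ (ω : Eucl d) (η : Eucl d)) * Y η ∂(surfMeasure d) = lam k * Y ω

/-- The matrix `diag(l, m) * [[M₂, M₁], [M₁, M₀]]`. -/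
def momentAction (d : ℕ) (p : ℝ → ℝ) (l m : ℝ) : Matrix (Fin 2) (Fin 2) ℝ :=
  !![l, 0; 0, m] *
    !![radialMoment d p 2, radialMoment d p 1; radialMoment d p 1, radialMoment d p 0]

end

/-!
In polar coordinates `(ω, r)` the measure `radialMeasure d p` is the product of the surface measure
of the sphere and of a finite radial law with second moment, and `k₀ + k₁` becomes the kernel
`r r' κ₀(ωᵀη) + κ₁(ωᵀη)`. Everything reduces to three facts about the sphere.

* Funk–Hecke (`exists_funkHecke`): a zonal operator acts on spherical harmonics of degree `k` as a
  scalar.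
* Harmonics of different degrees are orthogonal (`integral_sphericalHarmonics_mul_eq_zero`), and all
  harmonics together are complete (`ae_eq_zero_of_orthogonal_sphericalHarmonics`).
* The scalars of a bounded profile tend to zero (`finite_setOf_le_abs_funkHecke`), by Bessel's
  inequality.

The first two are derived from Gaussian integration by parts `E[xᵢ P] = E[∂ᵢ P]` for polynomials.
It gives `k E[PQ] = E[∇P · ∇Q]` for `P` harmonic and homogeneous of degree `k`; the right side is
symmetric, whence orthogonality. It also gives, by induction on `n`, that `E[(x·X)ⁿ P]` is
proportional to `P(x)` on the unit sphere, which is Funk–Hecke for the profiles `tⁿ`. Polar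
coordinates turn Gaussian integrals of homogeneous polynomials into positive multiples of integrals
over the sphere. The extension to bounded measurable profiles, and completeness, follow because
finite measures on a compact space are determined by their integrals over a separating algebra of
continuous functions; completeness also uses that a polynomial agrees on the sphere with a sum of
harmonic ones.

On `(α r + β) Y` with `Y` of degree `k`, the operator acts by the matrix `momentAction`, a product
of a diagonal matrix with the positive definite Gram matrix of `r` and `1`; such a product has a
basis of eigenvectors orthonormal for the Gram matrix (`exists_orthonormal_eigenbasis_mul`).
Conversely, the eigenvalue equation for `c ≠ 0` shows that an eigenfunction is `r g₁(ω) + g₀(ω)`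
with bounded `g₁`, `g₀`, and that the pair of coefficients of `g₁`, `g₀` along a harmonic of degree
`k` is in the eigenspace of `momentAction` for `c`. By the decay of the scalars these pairs vanish
for all but finitely many degrees, and completeness identifies the eigenfunction with the resulting
finite sum (`polar_eigenfunction_ae_eq_sum`). The kernel of order 1 alone is the case `k₁ = 0`.
-/

/-! ### Harmonic polynomials -/

section Algebra

open MvPolynomial

variable {d : ℕ}

lemma polyLaplacian_apply (P : MvPolynomial (Fin d) ℝ) :
    polyLaplacian d P = ∑ i, pderiv i (pderiv i P) := by
  simp [polyLaplacian, LinearMap.sum_apply]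

lemma pderiv_comm {σ R : Type*} [CommRing R] (i j : σ) (P : MvPolynomial σ R) :
    pderiv i (pderiv j P) = pderiv j (pderiv i P) := by
  classical
  have h : ⁅pderiv (R := R) i, pderiv (R := R) j⁆ = 0 := by
    refine derivation_ext fun l => ?_
    simp only [Derivation.commutator_apply, pderiv_X, Derivation.coe_zero, Pi.zero_apply,
      Pi.single_apply]
    split_ifs <;> simp
  have := congrArg (fun D : Derivation R _ _ => D P) h
  simpa [Derivation.commutator_apply, sub_eq_zero] using this

/-- The polynomial `∑ xᵢ²`. -/
noncomputable def normSqPoly (d : ℕ) : MvPolynomial (Fin d) ℝ := ∑ i, X i ^ 2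

lemma pderiv_normSqPoly (i : Fin d) : pderiv i (normSqPoly d) = 2 * X i := by
  classical
  simp [normSqPoly, pderiv_X, Pi.single_apply]

lemma normSqPoly_isHomogeneous : (normSqPoly d).IsHomogeneous 2 :=
  IsHomogeneous.sum _ _ _ fun i _ => by simpa using (isHomogeneous_X ℝ i).pow 2

lemma polyLaplacian_normSqPoly_mul (Q : MvPolynomial (Fin d) ℝ) :
    polyLaplacian d (normSqPoly d * Q) =
      normSqPoly d * polyLaplacian d Q + 4 * ∑ i, X i * pderiv i Q + 2 * (d : ℝ) • Q := by
  simp only [polyLaplacian_apply, pderiv_mul, pderiv_normSqPoly, map_add, pderiv_X_self]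
  have h2 : (2 * (d : ℝ) • Q) = ∑ _i : Fin d, 2 * Q := by simp [smul_eq_C_mul]; ring
  rw [h2, Finset.mul_sum, Finset.mul_sum, ← Finset.sum_add_distrib, ← Finset.sum_add_distrib]
  refine Finset.sum_congr rfl fun i _ => ?_
  have : pderiv i (2 : MvPolynomial (Fin d) ℝ) = 0 := by
    exact pderiv_C (a := (2 : ℝ))
  simp only [this]
  ring

/-- The harmonic homogeneous polynomials of degree `k`. -/
noncomputable def harmonicPolys (d k : ℕ) : Submodule ℝ (MvPolynomial (Fin d) ℝ) :=
  homogeneousSubmodule (Fin d) ℝ k ⊓ LinearMap.ker (polyLaplacian d)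

lemma mem_harmonicPolys {k : ℕ} {P : MvPolynomial (Fin d) ℝ} :
    P ∈ harmonicPolys d k ↔ P.IsHomogeneous k ∧ polyLaplacian d P = 0 := by
  simp [harmonicPolys]

lemma mem_sphericalHarmonics {k : ℕ} {Y : USphere d → ℝ} :
    Y ∈ sphericalHarmonics d k ↔ ∃ P ∈ harmonicPolys d k, restrictToSphere d P = Y := by
  rfl

/-- For `H` harmonic and homogeneous, `Δ(|x|^{2j+2} H)` is a positive multiple of `|x|^{2j} H`;
hence the Laplacian can be inverted on sums of such products. -/
lemma polyLaplacian_normSqPoly_pow_mul (hd : 1 ≤ d) {m : ℕ} {H : MvPolynomial (Fin d) ℝ}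
    (hH : H ∈ harmonicPolys d m) (j : ℕ) :
    ∃ c : ℝ, 0 < c ∧
      polyLaplacian d (normSqPoly d ^ (j + 1) * H) = c • (normSqPoly d ^ j * H) := by
  obtain ⟨h1, h2⟩ := mem_harmonicPolys.1 hH
  induction j with
  | zero =>
    refine ⟨4 * m + 2 * d, by positivity, ?_⟩
    rw [zero_add, pow_one, polyLaplacian_normSqPoly_mul, h1.sum_X_mul_pderiv, h2]
    simp [smul_eq_C_mul, map_ofNat]; ring
  | succ j ih =>
    obtain ⟨c, hc, h⟩ := ih
    refine ⟨c + 4 * (2 * (j + 1) + m) + 2 * d, by positivity, ?_⟩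
    have h3 : (normSqPoly d ^ (j + 1) * H).IsHomogeneous (2 * (j + 1) + m) :=
      (normSqPoly_isHomogeneous.pow (j + 1)).mul h1
    rw [pow_succ' _ (j + 1), mul_assoc, polyLaplacian_normSqPoly_mul, h, h3.sum_X_mul_pderiv]
    simp [smul_eq_C_mul, map_ofNat]; ring

/-- A homogeneous polynomial is a sum of products of powers of `|x|²` with harmonic homogeneous
polynomials. -/
theorem mem_span_normSqPoly_pow_mul_harmonic (hd : 1 ≤ d) (n : ℕ) (P : MvPolynomial (Fin d) ℝ)
    (hP : P.IsHomogeneous n) :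
    P ∈ Submodule.span ℝ {Q | ∃ j m, ∃ H ∈ harmonicPolys d m, 2 * j + m = n ∧
      Q = normSqPoly d ^ j * H} := by
  induction n using Nat.strong_induction_on generalizing P with
  | _ n ih =>
  rcases lt_or_ge n 2 with hn | hn
  · refine Submodule.subset_span ⟨0, n, P, mem_harmonicPolys.2 ⟨hP, ?_⟩, by simp, by simp⟩
    rw [polyLaplacian_apply]
    refine Finset.sum_eq_zero fun i _ => ?_
    have h1 : (pderiv i P).IsHomogeneous 0 := by
      have := hP.pderiv (i := i)
      rwa [show n - 1 = 0 by omega] at this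
    rw [← totalDegree_zero_iff_isHomogeneous, totalDegree_eq_zero_iff_eq_C] at h1
    rw [h1, pderiv_C]
  · have hΔ : (polyLaplacian d P).IsHomogeneous (n - 2) := by
      rw [polyLaplacian_apply]
      exact IsHomogeneous.sum _ _ _ fun i _ => by
        simpa [Nat.sub_sub] using (hP.pderiv (i := i)).pderiv (i := i)
    obtain ⟨R, hR, hRP⟩ : ∃ R ∈ Submodule.span ℝ {Q | ∃ j m, ∃ H ∈ harmonicPolys d m,
        2 * j + m = n ∧ Q = normSqPoly d ^ j * H}, polyLaplacian d R = polyLaplacian d P := by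
      have := ih (n - 2) (by omega) _ hΔ
      rw [← Submodule.mem_map]
      refine Submodule.span_le.2 ?_ this
      rintro _ ⟨j, m, H, hH, hjm, rfl⟩
      obtain ⟨c, hc, h⟩ := polyLaplacian_normSqPoly_pow_mul hd hH j
      refine ⟨c⁻¹ • (normSqPoly d ^ (j + 1) * H), Submodule.smul_mem _ _ <|
        Submodule.subset_span ⟨j + 1, m, H, hH, by omega, rfl⟩, ?_⟩
      rw [map_smul, h, inv_smul_smul₀ hc.ne']
    have hRn : R.IsHomogeneous n := by
      rw [← mem_homogeneousSubmodule]
      refine Submodule.span_le.2 ?_ hR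
      rintro _ ⟨j, m, H, hH, hjm, rfl⟩
      have := (normSqPoly_isHomogeneous.pow j).mul (mem_harmonicPolys.1 hH).1
      rwa [hjm] at this
    have : P - R ∈ harmonicPolys d n :=
      mem_harmonicPolys.2 ⟨hP.sub hRn, by rw [map_sub, hRP, sub_self]⟩
    rw [← sub_add_cancel P R]
    exact Submodule.add_mem _ (Submodule.subset_span ⟨0, n, _, this, by simp, by simp⟩) hR

/-- The derivative in the direction `x`. -/
noncomputable def dirDeriv (x : Fin d → ℝ) :
    Derivation ℝ (MvPolynomial (Fin d) ℝ) (MvPolynomial (Fin d) ℝ) :=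
  ∑ i, x i • pderiv i

lemma dirDeriv_apply (x : Fin d → ℝ) (P : MvPolynomial (Fin d) ℝ) :
    dirDeriv x P = ∑ i, x i • pderiv i P := by
  have := congrFun (map_sum (Derivation.coeFnAddMonoidHom (R := ℝ) (A := MvPolynomial (Fin d) ℝ)
    (M := MvPolynomial (Fin d) ℝ)) (fun i => x i • pderiv i) Finset.univ) P
  exact this.trans (Finset.sum_apply _ _ _)

/-- The linear form `x · X`. -/
noncomputable def linForm (x : Fin d → ℝ) : MvPolynomial (Fin d) ℝ := ∑ i, x i • X i

lemma dirDeriv_linForm (x : Fin d → ℝ) : dirDeriv x (linForm x) = C (∑ i, x i ^ 2) := by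
  classical
  simp [dirDeriv_apply, linForm, pderiv_X, Pi.single_apply, smul_eq_C_mul, sq]

lemma dirDeriv_mem_harmonicPolys (x : Fin d → ℝ) {k : ℕ} {P : MvPolynomial (Fin d) ℝ}
    (hP : P ∈ harmonicPolys d k) : dirDeriv x P ∈ harmonicPolys d (k - 1) := by
  obtain ⟨h1, h2⟩ := mem_harmonicPolys.1 hP
  rw [dirDeriv_apply]
  refine Submodule.sum_mem _ fun i _ => Submodule.smul_mem _ _ (mem_harmonicPolys.2 ⟨h1.pderiv, ?_⟩)
  have : polyLaplacian d (pderiv i P) = pderiv i (polyLaplacian d P) := by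
    simp only [polyLaplacian_apply, map_sum]
    exact Finset.sum_congr rfl fun j _ => by rw [pderiv_comm j i, pderiv_comm j i]
  rw [this, h2, map_zero]

lemma eval_dirDeriv (x : Fin d → ℝ) {k : ℕ} {P : MvPolynomial (Fin d) ℝ}
    (hP : P.IsHomogeneous k) : eval x (dirDeriv x P) = k * eval x P := by
  have := congrArg (eval x) hP.sum_X_mul_pderiv
  simpa [dirDeriv_apply, smul_eq_C_mul] using this

/-! ### Gaussian integration by parts for harmonic polynomials -/

/-- A linear functional on polynomials satisfying Gaussian integration by parts
`E[xᵢ P] = E[∂ᵢ P]`. -/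
def IsGaussianFunctional (E : MvPolynomial (Fin d) ℝ →ₗ[ℝ] ℝ) : Prop :=
  ∀ i P, E (X i * P) = E (pderiv i P)

namespace IsGaussianFunctional

variable {E : MvPolynomial (Fin d) ℝ →ₗ[ℝ] ℝ} (hE : IsGaussianFunctional E)

include hE

lemma map_harmonic {k : ℕ} (hk : k ≠ 0) {P : MvPolynomial (Fin d) ℝ} (hP : P ∈ harmonicPolys d k) :
    E P = 0 := by
  obtain ⟨h1, h2⟩ := mem_harmonicPolys.1 hP
  have : (k : ℝ) * E P = 0 := by
    rw [← smul_eq_mul, ← map_smul, Nat.cast_smul_eq_nsmul, ← h1.sum_X_mul_pderiv, map_sum]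
    simp_rw [hE _ _]
    rw [← map_sum, ← polyLaplacian_apply, h2, map_zero]
  simpa [hk] using this

/-- `k E[PQ] = E[∇P · ∇Q]` for `P` harmonic homogeneous of degree `k`. -/
lemma degree_mul_map_mul {k : ℕ} {P : MvPolynomial (Fin d) ℝ} (hP : P ∈ harmonicPolys d k)
    (Q : MvPolynomial (Fin d) ℝ) :
    (k : ℝ) * E (P * Q) = E (∑ i, pderiv i P * pderiv i Q) := by
  obtain ⟨h1, h2⟩ := mem_harmonicPolys.1 hP
  have h3 : (k : ℝ) * E (P * Q) = E ((k • P) * Q) := by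
    rw [smul_mul_assoc, map_nsmul, nsmul_eq_mul]
  rw [h3, ← h1.sum_X_mul_pderiv, Finset.sum_mul, map_sum]
  simp_rw [mul_assoc, hE _ _, pderiv_mul]
  rw [← map_sum, Finset.sum_add_distrib, ← Finset.sum_mul, ← polyLaplacian_apply, h2, zero_mul,
    zero_add]

lemma map_mul_eq_zero {k l : ℕ} (hkl : k ≠ l) {P Q : MvPolynomial (Fin d) ℝ}
    (hP : P ∈ harmonicPolys d k) (hQ : Q ∈ harmonicPolys d l) : E (P * Q) = 0 := by
  have h1 := hE.degree_mul_map_mul hP Q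
  have h2 := hE.degree_mul_map_mul hQ P
  simp_rw [mul_comm Q P, mul_comm (pderiv _ Q)] at h2
  have h3 : ((k : ℝ) - l) * E (P * Q) = 0 := by rw [sub_mul, h1, h2, sub_self]
  exact (mul_eq_zero.1 h3).resolve_left (sub_ne_zero.2 (by exact_mod_cast hkl))

lemma map_linForm_mul (x : Fin d → ℝ) (P : MvPolynomial (Fin d) ℝ) :
    E (linForm x * P) = E (dirDeriv x P) := by
  simp [linForm, dirDeriv_apply, Finset.sum_mul, hE _ _]

/-- The Funk–Hecke formula for the powers `tⁿ`, in Gaussian form. Integration by parts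
lowers `n`, and differentiating `P` along `x` lowers the degree while keeping it harmonic. -/
theorem exists_map_linForm_pow_mul (n k : ℕ) :
    ∃ c : ℝ, ∀ P ∈ harmonicPolys d k, ∀ x : Fin d → ℝ, ∑ i, x i ^ 2 = 1 →
      E (linForm x ^ n * P) = c * eval x P := by
  induction n using Nat.strong_induction_on generalizing k with
  | _ n ih =>
  rcases n with _ | n
  · rcases eq_or_ne k 0 with rfl | hk
    · refine ⟨E 1, fun P hP x _ => ?_⟩
      have h1 := (mem_harmonicPolys.1 hP).1
      rw [← totalDegree_zero_iff_isHomogeneous, totalDegree_eq_zero_iff_eq_C] at h1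
      rw [h1, pow_zero, one_mul, eval_C, ← mul_one (C _), ← smul_eq_C_mul, map_smul, smul_eq_mul,
        mul_comm]
    · exact ⟨0, fun P hP x _ => by rw [pow_zero, one_mul, hE.map_harmonic hk hP, zero_mul]⟩
  · obtain ⟨c₁, h₁⟩ := ih (n - 1) (by omega) k
    obtain ⟨c₂, h₂⟩ := ih n (by omega) (k - 1)
    refine ⟨n * c₁ + k * c₂, fun P hP x hx => ?_⟩
    rw [pow_succ', mul_assoc, hE.map_linForm_mul, Derivation.leibniz, Derivation.leibniz_pow,
      dirDeriv_linForm, hx, map_add, smul_eq_mul, h₂ _ (dirDeriv_mem_harmonicPolys x hP) x hx,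
      eval_dirDeriv x (mem_harmonicPolys.1 hP).1]
    have : P • n • linForm x ^ (n - 1) • (C 1 : MvPolynomial (Fin d) ℝ) =
        (n : ℝ) • (linForm x ^ (n - 1) * P) := by
      simp only [smul_eq_mul, nsmul_eq_mul, smul_eq_C_mul, map_natCast, map_one]; ring
    rw [this, map_smul, h₁ P hP x hx, smul_eq_mul]
    ring

end IsGaussianFunctional

end Algebra

/-! ### Polar coordinates -/

section Polar

variable {d : ℕ}

lemma eucl_nontrivial (hd : 1 ≤ d) : Nontrivial (Eucl d) :=
  have : Nonempty (Fin d) := ⟨⟨0, hd⟩⟩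
  inferInstance

instance : IsFiniteMeasure (surfMeasure d) := by
  unfold surfMeasure; infer_instance

/-- Polar coordinates `(ω, r) ↦ r ω`. -/
noncomputable def polarMap (d : ℕ) (q : USphere d × Ioi (0 : ℝ)) : Eucl d :=
  (q.2 : ℝ) • (q.1 : Eucl d)

lemma polarMap_eq : polarMap d = Subtype.val ∘ (homeomorphUnitSphereProd (Eucl d)).symm := by
  ext q : 1
  simp [polarMap]

lemma measurableEmbedding_polarMap : MeasurableEmbedding (polarMap d) := by
  rw [polarMap_eq]
  exact (MeasurableEmbedding.subtype_coe (measurableSet_singleton _).compl).comp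
    (Homeomorph.measurableEmbedding _)

lemma norm_polarMap (q : USphere d × Ioi (0 : ℝ)) : ‖polarMap d q‖ = q.2 := by
  have := q.2.2.out
  simp [polarMap, norm_smul, abs_of_pos this]

lemma polarMap_ne_zero (q : USphere d × Ioi (0 : ℝ)) : polarMap d q ≠ 0 := by
  rw [← norm_pos_iff, norm_polarMap]
  exact q.2.2

lemma exists_polarMap_eq {x : Eucl d} (hx : x ≠ 0) : ∃ q, polarMap d q = x := by
  refine ⟨homeomorphUnitSphereProd (Eucl d) ⟨x, hx⟩, ?_⟩
  simp [polarMap_eq]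

lemma map_polarMap_prod_volumeIoiPow (hd : 1 ≤ d) :
    ((surfMeasure d).prod (Measure.volumeIoiPow (d - 1))).map (polarMap d) = volume := by
  have := eucl_nontrivial hd
  have h := (volume : Measure (Eucl d)).measurePreserving_homeomorphUnitSphereProd
  rw [finrank_euclideanSpace_fin] at h
  have h2 := h.symm (homeomorphUnitSphereProd (Eucl d)).toMeasurableEquiv
  have h3 : Measure.map (homeomorphUnitSphereProd (Eucl d)).symm
      ((surfMeasure d).prod (Measure.volumeIoiPow (d - 1))) =
      (volume : Measure (Eucl d)).comap Subtype.val := h2.map_eq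
  rw [polarMap_eq, ← Measure.map_map measurable_subtype_coe (Homeomorph.measurable _), h3,
    (MeasurableEmbedding.subtype_coe (measurableSet_singleton _).compl).map_comap,
    Subtype.range_coe, restrict_compl_singleton]

/-- The measure on `(0, ∞)` with density `r^{d-1} max(w(r), 0)`, for `w ≥ 0` the radial
part of the measure with density `w(‖x‖)` on `ℝ^d`. -/
noncomputable def radialPart (d : ℕ) (w : ℝ → ℝ) : Measure (Ioi (0 : ℝ)) :=
  (Measure.volumeIoiPow (d - 1)).withDensity fun r => ENNReal.ofReal (w r)

instance (w : ℝ → ℝ) : SFinite (radialPart d w) := by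
  unfold radialPart; infer_instance

lemma withDensity_norm_eq_map_polarMap (hd : 1 ≤ d) {w : ℝ → ℝ} (hw : Measurable w) :
    (volume : Measure (Eucl d)).withDensity (fun x => ENNReal.ofReal (w ‖x‖)) =
      ((surfMeasure d).prod (radialPart d w)).map (polarMap d) := by
  have hm : Measurable fun r : Ioi (0 : ℝ) => ENNReal.ofReal (w r) := by fun_prop
  rw [radialPart, prod_withDensity_right hm]
  ext s hs
  have he := measurableEmbedding_polarMap (d := d)
  rw [withDensity_apply _ hs, ← map_polarMap_prod_volumeIoiPow hd, he.restrict_map,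
    he.lintegral_map, he.map_apply, withDensity_apply _ (he.measurable hs)]
  simp_rw [norm_polarMap]

lemma radialPart_eq {w : ℝ → ℝ} (hw : Measurable w) :
    radialPart d w = (Measure.comap Subtype.val volume : Measure (Ioi (0 : ℝ))).withDensity
      fun r => ENNReal.ofReal (r.1 ^ (d - 1) * w r) := by
  rw [radialPart, Measure.volumeIoiPow, ← withDensity_mul _ (by fun_prop) (by fun_prop)]
  congr 1
  ext r
  rw [Pi.mul_apply, ENNReal.ofReal_mul (pow_nonneg r.2.out.le _)]

lemma integrable_radialPart_iff {w : ℝ → ℝ} (hw : Measurable w) (hw0 : ∀ r, 0 < r → 0 ≤ w r)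
    (f : ℝ → ℝ) : Integrable (fun r : Ioi (0 : ℝ) => f r) (radialPart d w) ↔
      IntegrableOn (fun r => r ^ (d - 1) * w r * f r) (Ioi 0) := by
  rw [radialPart_eq hw, integrable_withDensity_iff_integrable_smul' (by fun_prop) (by simp),
    integrableOn_iff_comap_subtypeVal measurableSet_Ioi]
  refine integrable_congr (.of_forall fun r => ?_)
  have := mul_nonneg (pow_nonneg r.2.out.le (d - 1)) (hw0 _ r.2)
  simp [ENNReal.toReal_ofReal this]

lemma integral_radialPart {w : ℝ → ℝ} (hw : Measurable w) (hw0 : ∀ r, 0 < r → 0 ≤ w r)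
    (f : ℝ → ℝ) : ∫ r : Ioi (0 : ℝ), f r ∂(radialPart d w) =
      ∫ r in Ioi 0, r ^ (d - 1) * w r * f r := by
  rw [radialPart_eq hw, integral_withDensity_eq_integral_toReal_smul (by fun_prop) (by simp),
    ← integral_subtype_comap measurableSet_Ioi]
  refine integral_congr_ae (.of_forall fun r => ?_)
  have := mul_nonneg (pow_nonneg r.2.out.le (d - 1)) (hw0 _ r.2)
  simp [ENNReal.toReal_ofReal this]

end Polar

/-! ### The Gaussian functional and integrals over the sphere -/

section Gaussian

open MvPolynomial

variable {d : ℕ}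

/-- A polynomial as a function on `ℝ^d`. -/
noncomputable def evalEucl (P : MvPolynomial (Fin d) ℝ) (x : Eucl d) : ℝ := eval (fun i => x i) P

lemma restrictToSphere_apply (P : MvPolynomial (Fin d) ℝ) (ω : USphere d) :
    restrictToSphere d P ω = evalEucl P ω := rfl

lemma continuous_evalEucl (P : MvPolynomial (Fin d) ℝ) : Continuous (evalEucl P) := by
  have : Continuous fun x : Eucl d => fun i => x i := by fun_prop
  exact (MvPolynomial.continuous_eval P).comp this

lemma continuous_restrictToSphere (P : MvPolynomial (Fin d) ℝ) :
    Continuous (restrictToSphere d P) :=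
  (continuous_evalEucl P).comp continuous_subtype_val

lemma integrable_of_continuous {X : Type*} [TopologicalSpace X] [CompactSpace X] [T2Space X]
    [MeasurableSpace X] [BorelSpace X] {μ : Measure X} [IsFiniteMeasure μ] {f : X → ℝ}
    (hf : Continuous f) : Integrable f μ :=
  integrableOn_univ.1 (hf.continuousOn.integrableOn_compact isCompact_univ)

lemma evalEucl_polarMap {n : ℕ} {P : MvPolynomial (Fin d) ℝ} (hP : P.IsHomogeneous n)
    (q : USphere d × Ioi (0 : ℝ)) :
    evalEucl P (polarMap d q) = restrictToSphere d P q.1 * (q.2 : ℝ) ^ n := by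
  rw [restrictToSphere_apply, mul_comm, evalEucl, evalEucl, eval_eq', eval_eq', Finset.mul_sum]
  refine Finset.sum_congr rfl fun m hm => ?_
  have hdeg : ∑ i, m i = n := by
    have := hP (mem_support_iff.1 hm)
    simpa [Finsupp.weight_apply, Finsupp.sum_fintype] using this
  simp only [polarMap, PiLp.smul_apply, smul_eq_mul, mul_pow, Finset.prod_mul_distrib,
    Finset.prod_pow_eq_pow_sum, hdeg]
  ring

/-- The weight `e^{-r²/2}`. -/
noncomputable def gaussWeight (r : ℝ) : ℝ := Real.exp (-(r ^ 2) / 2)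

lemma measurable_gaussWeight : Measurable gaussWeight := by unfold gaussWeight; fun_prop

lemma gaussWeight_pos (r : ℝ) : 0 < gaussWeight r := Real.exp_pos _

lemma integrable_gauss_pow (n : ℕ) :
    Integrable (fun r : Ioi (0 : ℝ) => (r : ℝ) ^ n) (radialPart d gaussWeight) := by
  rw [integrable_radialPart_iff measurable_gaussWeight (fun r _ => (gaussWeight_pos r).le)
    (fun r => r ^ n)]
  have h := integrableOn_rpow_mul_exp_neg_mul_sq (b := 1 / 2) (by norm_num)
    (s := ((d - 1 + n : ℕ) : ℝ)) (by linarith [Nat.cast_nonneg (α := ℝ) (d - 1 + n)])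
  refine h.congr_fun (fun r _ => ?_) measurableSet_Ioi
  simp only [Real.rpow_natCast, gaussWeight, pow_add]
  rw [show -(1 / 2) * r ^ 2 = -(r ^ 2) / 2 by ring]
  ring

/-- The radial moments of the Gaussian. -/
noncomputable def gaussMoment (d n : ℕ) : ℝ :=
  ∫ r : Ioi (0 : ℝ), (r : ℝ) ^ n ∂(radialPart d gaussWeight)

lemma gaussMoment_pos (n : ℕ) : 0 < gaussMoment d n := by
  have hi := (integrable_radialPart_iff measurable_gaussWeight (fun r _ => (gaussWeight_pos r).le)
    (fun r => r ^ n)).1 (integrable_gauss_pow (d := d) n)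
  rw [gaussMoment, integral_radialPart measurable_gaussWeight (fun r _ => (gaussWeight_pos r).le)
    (fun r => r ^ n)]
  have hpos : ∀ r ∈ Ioi (0 : ℝ), 0 < r ^ (d - 1) * gaussWeight r * r ^ n := fun r hr =>
    mul_pos (mul_pos (pow_pos hr _) (gaussWeight_pos r)) (pow_pos hr _)
  rw [setIntegral_pos_iff_support_of_nonneg_ae
    ((ae_restrict_mem measurableSet_Ioi).mono fun r hr => (hpos r hr).le) hi]
  have : Function.support (fun r : ℝ => r ^ (d - 1) * gaussWeight r * r ^ n) ∩ Ioi 0 = Ioi 0 :=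
    inter_eq_right.2 fun r hr => (hpos r hr).ne'
  rw [this]
  simp

/-- The (unnormalized) Gaussian measure. -/
noncomputable def gaussMeasure (d : ℕ) : Measure (Eucl d) :=
  volume.withDensity fun x => ENNReal.ofReal (gaussWeight ‖x‖)

lemma gaussMeasure_eq (hd : 1 ≤ d) :
    gaussMeasure d = ((surfMeasure d).prod (radialPart d gaussWeight)).map (polarMap d) :=
  withDensity_norm_eq_map_polarMap hd measurable_gaussWeight

lemma integrable_evalEucl_gaussMeasure (hd : 1 ≤ d) (P : MvPolynomial (Fin d) ℝ) :
    Integrable (evalEucl P) (gaussMeasure d) := by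
  rw [gaussMeasure_eq hd, measurableEmbedding_polarMap.integrable_map_iff]
  have hsum : evalEucl P = fun x => ∑ n ∈ Finset.range (P.totalDegree + 1),
      evalEucl (homogeneousComponent n P) x := by
    ext x
    conv_lhs => rw [← sum_homogeneousComponent P]
    simp [evalEucl]
  rw [hsum]
  have : ∀ n, Integrable (evalEucl (homogeneousComponent n P) ∘ polarMap d)
      ((surfMeasure d).prod (radialPart d gaussWeight)) := fun n => by
    have : evalEucl (homogeneousComponent n P) ∘ polarMap d = fun q =>
        restrictToSphere d (homogeneousComponent n P) q.1 * (q.2 : ℝ) ^ n := by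
      ext q
      exact evalEucl_polarMap (homogeneousComponent_isHomogeneous n P) q
    rw [this]
    exact (integrable_of_continuous (continuous_restrictToSphere _)).mul_prod
      (integrable_gauss_pow n)
  exact integrable_finsetSum _ fun n _ => this n

lemma integrable_evalEucl_mul_gaussWeight (hd : 1 ≤ d) (P : MvPolynomial (Fin d) ℝ) :
    Integrable fun x : Eucl d => evalEucl P x * gaussWeight ‖x‖ := by
  have h := integrable_evalEucl_gaussMeasure hd P
  have := measurable_gaussWeight
  rw [gaussMeasure, integrable_withDensity_iff_integrable_smul' (by fun_prop) (by simp)] at h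
  simpa [ENNReal.toReal_ofReal (gaussWeight_pos _).le, mul_comm] using h

lemma integral_gaussMeasure (f : Eucl d → ℝ) :
    ∫ x, f x ∂(gaussMeasure d) = ∫ x, f x * gaussWeight ‖x‖ := by
  have := measurable_gaussWeight
  rw [gaussMeasure, integral_withDensity_eq_integral_toReal_smul (by fun_prop) (by simp)]
  simp [ENNReal.toReal_ofReal (gaussWeight_pos _).le, mul_comm]

/-- Integration of polynomials against the Gaussian measure. -/
noncomputable def gaussFunctional (hd : 1 ≤ d) : MvPolynomial (Fin d) ℝ →ₗ[ℝ] ℝ where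
  toFun P := ∫ x, evalEucl P x ∂(gaussMeasure d)
  map_add' P Q := by
    rw [← integral_add (integrable_evalEucl_gaussMeasure hd P)
      (integrable_evalEucl_gaussMeasure hd Q)]
    simp [evalEucl]
  map_smul' c P := by
    rw [RingHom.id_apply, smul_eq_mul, ← integral_const_mul c (evalEucl P)]
    simp [evalEucl]

lemma gaussFunctional_apply_of_isHomogeneous (hd : 1 ≤ d) {n : ℕ} {P : MvPolynomial (Fin d) ℝ}
    (hP : P.IsHomogeneous n) :
    gaussFunctional hd P = (∫ ω, restrictToSphere d P ω ∂(surfMeasure d)) * gaussMoment d n := by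
  change ∫ x, evalEucl P x ∂(gaussMeasure d) = _
  rw [gaussMeasure_eq hd, measurableEmbedding_polarMap.integral_map]
  simp_rw [evalEucl_polarMap hP]
  exact integral_prod_mul (restrictToSphere d P) fun r : Ioi (0 : ℝ) => (r : ℝ) ^ n

lemma hasDerivAt_evalEucl (P : MvPolynomial (Fin d) ℝ) (x : Eucl d) (i : Fin d) :
    HasLineDerivAt ℝ (evalEucl P) (evalEucl (pderiv i P) x) x (EuclideanSpace.single i 1) := by
  classical
  induction P using MvPolynomial.induction_on with
  | C a => simpa [evalEucl, HasLineDerivAt] using hasDerivAt_const (0 : ℝ) a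
  | add p q hp hq =>
    have := HasDerivAt.add (f := fun t : ℝ => evalEucl p (x + t • EuclideanSpace.single i 1))
      (g := fun t : ℝ => evalEucl q (x + t • EuclideanSpace.single i 1)) hp hq
    simpa [evalEucl, HasLineDerivAt, Pi.add_def] using this
  | mul_X p j hp =>
    have hX : HasDerivAt (fun t : ℝ => (x + t • EuclideanSpace.single i (1 : ℝ)) j)
        (if j = i then 1 else 0) 0 := by
      by_cases h : j = i
      · simpa [h] using (hasDerivAt_id (0 : ℝ)).const_add (x i)
      · simpa [h] using hasDerivAt_const (0 : ℝ) (x j)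
    have := HasDerivAt.mul (c := fun t : ℝ => evalEucl p (x + t • EuclideanSpace.single i 1)) hp hX
    have h2 : evalEucl (pderiv i (p * X j)) x = evalEucl (pderiv i p) x * x j +
        evalEucl p x * (if j = i then 1 else 0) := by
      by_cases h : j = i <;> simp [evalEucl, pderiv_X, h, mul_comm, add_comm]
    rw [h2]
    unfold HasLineDerivAt
    convert! this using 1
    · ext t; simp [evalEucl]
    · simp

lemma hasLineDerivAt_gaussWeight_norm (x : Eucl d) (i : Fin d) :
    HasLineDerivAt ℝ (fun x : Eucl d => gaussWeight ‖x‖) (-(x i * gaussWeight ‖x‖)) x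
      (EuclideanSpace.single i 1) := by
  have hn : ∀ t : ℝ, ‖x + t • EuclideanSpace.single i (1 : ℝ)‖ ^ 2 =
      ‖x‖ ^ 2 + 2 * (t * x i) + t ^ 2 := fun t => by
    rw [norm_add_sq_real, inner_smul_right, norm_smul]
    simp [EuclideanSpace.inner_single_right]
  unfold HasLineDerivAt gaussWeight
  simp_rw [hn]
  have h1 : HasDerivAt (fun t : ℝ => -(‖x‖ ^ 2 + 2 * (t * x i) + t ^ 2) / 2) (-(x i)) 0 := by
    have := (((((hasDerivAt_id (0 : ℝ)).mul_const (x i)).const_mul 2).const_add (‖x‖ ^ 2)).add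
      ((hasDerivAt_id (0 : ℝ)).pow 2)).neg.div_const 2
    convert! this using 1
    simp [neg_div]
  have := h1.exp
  convert! this using 1
  simp [mul_comm]

lemma isGaussianFunctional_gaussFunctional (hd : 1 ≤ d) :
    IsGaussianFunctional (gaussFunctional hd) := by
  intro i P
  change ∫ x, evalEucl (X i * P) x ∂(gaussMeasure d) =
    ∫ x, evalEucl (pderiv i P) x ∂(gaussMeasure d)
  rw [integral_gaussMeasure, integral_gaussMeasure]
  have hX : ∀ x : Eucl d, evalEucl P x * -(x i * gaussWeight ‖x‖) =
      -(evalEucl (X i * P) x * gaussWeight ‖x‖) := fun x => by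
    simp [evalEucl]; ring
  have h := integral_bilinear_hasLineDerivAt_right_eq_neg_left_of_integrable
    (μ := (volume : Measure (Eucl d))) (B := ContinuousLinearMap.mul ℝ ℝ)
    (f := evalEucl P) (f' := evalEucl (pderiv i P)) (g := fun x : Eucl d => gaussWeight ‖x‖)
    (g' := fun x => -(x i * gaussWeight ‖x‖)) (v := EuclideanSpace.single i 1)
    (integrable_evalEucl_mul_gaussWeight hd _)
    (by
      simp only [ContinuousLinearMap.mul_apply', hX]
      exact (integrable_evalEucl_mul_gaussWeight hd _).neg)
    (integrable_evalEucl_mul_gaussWeight hd _)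
    (fun x _ => hasDerivAt_evalEucl P x i) (fun x _ => hasLineDerivAt_gaussWeight_norm x i)
  simp only [ContinuousLinearMap.mul_apply', hX, integral_neg, neg_inj] at h
  exact h

/-- Spherical harmonics of different degrees are orthogonal. -/
theorem integral_sphericalHarmonics_mul_eq_zero (hd : 1 ≤ d) {k l : ℕ} (hkl : k ≠ l)
    {Y Z : USphere d → ℝ} (hY : Y ∈ sphericalHarmonics d k) (hZ : Z ∈ sphericalHarmonics d l) :
    ∫ ω, Y ω * Z ω ∂(surfMeasure d) = 0 := by
  obtain ⟨P, hP, rfl⟩ := mem_sphericalHarmonics.1 hY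
  obtain ⟨Q, hQ, rfl⟩ := mem_sphericalHarmonics.1 hZ
  have h := (isGaussianFunctional_gaussFunctional hd).map_mul_eq_zero hkl hP hQ
  rw [gaussFunctional_apply_of_isHomogeneous hd
    ((mem_harmonicPolys.1 hP).1.mul (mem_harmonicPolys.1 hQ).1)] at h
  simpa [restrictToSphere_apply, evalEucl] using
    (mul_eq_zero.1 h).resolve_right (gaussMoment_pos _).ne'

lemma sum_sq_coe_sphere (ω : USphere d) : ∑ i, (ω : Eucl d) i ^ 2 = 1 := by
  rw [← EuclideanSpace.real_norm_sq_eq]; simp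

/-- The Funk–Hecke formula for the kernels `(ωᵀη)ⁿ`. -/
theorem exists_integral_inner_pow_mul (hd : 1 ≤ d) (n k : ℕ) :
    ∃ c : ℝ, ∀ Y ∈ sphericalHarmonics d k, ∀ ω : USphere d,
      ∫ η : USphere d, inner ℝ (ω : Eucl d) (η : Eucl d) ^ n * Y η ∂(surfMeasure d) = c * Y ω := by
  obtain ⟨c, hc⟩ := (isGaussianFunctional_gaussFunctional hd).exists_map_linForm_pow_mul n k
  refine ⟨c / gaussMoment d (n + k), fun Y hY ω => ?_⟩
  obtain ⟨P, hP, rfl⟩ := mem_sphericalHarmonics.1 hY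
  have h := hc P hP (fun i => (ω : Eucl d) i) (sum_sq_coe_sphere ω)
  have hl : (linForm fun i => (ω : Eucl d) i).IsHomogeneous 1 :=
    IsHomogeneous.sum _ _ _ fun i _ => by
      rw [smul_eq_C_mul]; simpa using (isHomogeneous_C _ _).mul (isHomogeneous_X ℝ i)
  rw [gaussFunctional_apply_of_isHomogeneous hd
    ((hl.pow n).mul (mem_harmonicPolys.1 hP).1), one_mul] at h
  rw [div_mul_eq_mul_div, eq_div_iff (gaussMoment_pos _).ne']
  refine Eq.trans ?_ h
  congr 2
  ext η
  simp [restrictToSphere_apply, evalEucl, linForm, PiLp.inner_apply, mul_comm]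

end Gaussian

/-! ### Measures determined by a separating algebra of functions -/

section Separating

variable {X : Type*} [TopologicalSpace X] [CompactSpace X] [PolishSpace X] [MeasurableSpace X]
  [BorelSpace X]

/-- On a compact Polish space, finite measures are determined by their integrals over an algebra
of continuous functions which separates points. -/
lemma measure_ext_of_separatesPoints {μ ν : Measure X} [IsFiniteMeasure μ] [IsFiniteMeasure ν]
    {A : Subalgebra ℝ C(X, ℝ)} (hA : A.SeparatesPoints)
    (h : ∀ g ∈ A, ∫ x, g x ∂μ = ∫ x, g x ∂ν) : μ = ν := by
  let B : StarSubalgebra ℝ (BoundedContinuousFunction X ℝ) :=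
    { A.comap (BoundedContinuousFunction.toContinuousMapₐ ℝ) with
      star_mem' := fun {a} ha => by
        have : star a = a := by ext x; simp
        rwa [this] }
  refine ext_of_forall_mem_subalgebra_integral_eq_of_polish (A := B) (fun x y hxy => ?_)
    fun g hg => h g.toContinuousMap hg
  obtain ⟨_, ⟨f, hf, rfl⟩, hfxy⟩ := hA hxy
  exact ⟨f, ⟨f, ⟨BoundedContinuousFunction.mkOfCompact f, hf, rfl⟩, rfl⟩, hfxy⟩

lemma integral_withDensity_ofReal {X : Type*} [MeasurableSpace X] {μ : Measure X} {w : X → ℝ}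
    (hw : Measurable w) (hw0 : ∀ x, 0 ≤ w x) (f : X → ℝ) :
    ∫ x, f x ∂(μ.withDensity fun x => ENNReal.ofReal (w x)) = ∫ x, f x * w x ∂μ := by
  rw [integral_withDensity_eq_integral_toReal_smul (by fun_prop) (by simp)]
  simp [ENNReal.toReal_ofReal (hw0 _), mul_comm]

lemma integrable_of_bounded {X : Type*} [MeasurableSpace X] {μ : Measure X} [IsFiniteMeasure μ]
    {f : X → ℝ} (hf : Measurable f) {C : ℝ} (hC : ∀ x, |f x| ≤ C) : Integrable f μ :=
  Integrable.of_bound hf.aestronglyMeasurable C (.of_forall hC)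

lemma isFiniteMeasure_withDensity_of_bounded {X : Type*} [MeasurableSpace X] {μ : Measure X}
    [IsFiniteMeasure μ] {w : X → ℝ} (hw : Measurable w) {C : ℝ} (hC : ∀ x, |w x| ≤ C) :
    IsFiniteMeasure (μ.withDensity fun x => ENNReal.ofReal (w x)) :=
  isFiniteMeasure_withDensity_ofReal (integrable_of_bounded hw hC).2

/-- A bounded function orthogonal to a separating algebra of continuous functions vanishes almost
everywhere. -/
lemma ae_eq_zero_of_integral_mul_eq_zero {μ : Measure X} [IsFiniteMeasure μ]
    {A : Subalgebra ℝ C(X, ℝ)} (hA : A.SeparatesPoints) {f : X → ℝ} (hf : Measurable f) {C : ℝ}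
    (hC : ∀ x, |f x| ≤ C) (h : ∀ g ∈ A, ∫ x, f x * g x ∂μ = 0) : f =ᵐ[μ] 0 := by
  have hf0 : ∀ x, 0 ≤ f x + C := fun x => by linarith [neg_abs_le (f x), hC x]
  have hfC : ∀ x, |f x + C| ≤ 2 * C := fun x => by
    rw [abs_of_nonneg (hf0 x)]; linarith [le_abs_self (f x), hC x]
  have hC0 : ∀ _ : X, 0 ≤ C := fun x => (abs_nonneg _).trans (hC x)
  have := isFiniteMeasure_withDensity_of_bounded (μ := μ) (hf.add_const C) hfC
  have := isFiniteMeasure_withDensity_of_bounded (μ := μ) (w := fun _ => C) measurable_const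
    (fun x => (abs_of_nonneg (hC0 x)).le)
  -- `f` itself is signed, so the measures with densities `f + C` and `C` are compared
  have heq : μ.withDensity (fun x => ENNReal.ofReal (f x + C)) =
      μ.withDensity fun _ => ENNReal.ofReal C := by
    refine measure_ext_of_separatesPoints hA fun g hg => ?_
    rw [integral_withDensity_ofReal (hf.add_const C) hf0,
      integral_withDensity_ofReal measurable_const hC0]
    have hg1 : Integrable g μ := integrable_of_continuous g.continuous
    have hg2 : Integrable (fun x => f x * g x) μ :=
      hg1.bdd_mul hf.aestronglyMeasurable (.of_forall hC)
    have : ∀ x, g x * (f x + C) = f x * g x + g x * C := fun x => by ring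
    simp_rw [this]
    rw [integral_add hg2 (hg1.mul_const C), h g hg, zero_add]
  have hae := (withDensity_eq_iff_of_sigmaFinite (by fun_prop) (by fun_prop)).1 heq
  filter_upwards [hae] with x hx
  have := (ENNReal.ofReal_eq_ofReal_iff (hf0 x) (hC0 x)).1 hx
  simpa using this

end Separating

/-! ### Completeness of the spherical harmonics -/

section Completeness

open MvPolynomial

variable {d : ℕ}

lemma restrictToSphere_normSqPoly_pow_mul (j : ℕ) (H : MvPolynomial (Fin d) ℝ) :
    restrictToSphere d (normSqPoly d ^ j * H) = restrictToSphere d H := by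
  ext ω
  have := sum_sq_coe_sphere ω
  simp [restrictToSphere, normSqPoly, this]

lemma continuous_sphericalHarmonic {k : ℕ} {Y : USphere d → ℝ} (hY : Y ∈ sphericalHarmonics d k) :
    Continuous Y := by
  obtain ⟨P, _, rfl⟩ := mem_sphericalHarmonics.1 hY
  exact continuous_restrictToSphere P

/-- Every polynomial restricts to a sum of spherical harmonics on the sphere. -/
lemma restrictToSphere_mem_iSup (hd : 1 ≤ d) (P : MvPolynomial (Fin d) ℝ) :
    restrictToSphere d P ∈ ⨆ k, sphericalHarmonics d k := by
  rw [← sum_homogeneousComponent P, map_sum]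
  refine Submodule.sum_mem _ fun n _ => ?_
  rw [← Submodule.mem_comap]
  refine Submodule.span_le.2 ?_ (mem_span_normSqPoly_pow_mul_harmonic hd n _
    (homogeneousComponent_isHomogeneous n P))
  rintro _ ⟨j, m, H, hH, _, rfl⟩
  rw [SetLike.mem_coe, Submodule.mem_comap, restrictToSphere_normSqPoly_pow_mul]
  exact Submodule.mem_iSup_of_mem m (mem_sphericalHarmonics.2 ⟨H, hH, rfl⟩)

/-- The algebra of polynomial functions on the sphere. -/
noncomputable def spherePolynomials (d : ℕ) : Subalgebra ℝ C(USphere d, ℝ) where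
  carrier := {g | ∃ P, ⇑g = restrictToSphere d P}
  mul_mem' := by
    rintro f g ⟨P, hP⟩ ⟨Q, hQ⟩
    exact ⟨P * Q, by ext ω; simp [hP, hQ, restrictToSphere]⟩
  add_mem' := by
    rintro f g ⟨P, hP⟩ ⟨Q, hQ⟩
    exact ⟨P + Q, by ext ω; simp [hP, hQ, restrictToSphere]⟩
  algebraMap_mem' c := ⟨C c, by ext ω; simp [restrictToSphere]⟩

lemma spherePolynomials_separatesPoints : (spherePolynomials d).SeparatesPoints := by
  intro x y hxy
  obtain ⟨i, hi⟩ : ∃ i, (x : Eucl d) i ≠ (y : Eucl d) i := by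
    by_contra! h
    exact hxy (Subtype.ext (PiLp.ext h))
  exact ⟨_, ⟨⟨_, continuous_restrictToSphere (X i)⟩, ⟨X i, rfl⟩, rfl⟩,
    by simpa [restrictToSphere] using hi⟩

/-- Completeness: a bounded function orthogonal to all spherical harmonics vanishes almost
everywhere. -/
theorem ae_eq_zero_of_orthogonal_sphericalHarmonics (hd : 1 ≤ d) {h : USphere d → ℝ}
    (hh : Measurable h) {C : ℝ} (hC : ∀ ω, |h ω| ≤ C)
    (horth : ∀ k, ∀ Y ∈ sphericalHarmonics d k, ∫ ω, h ω * Y ω ∂(surfMeasure d) = 0) :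
    h =ᵐ[surfMeasure d] 0 := by
  refine ae_eq_zero_of_integral_mul_eq_zero spherePolynomials_separatesPoints hh hC ?_
  rintro g ⟨P, hP⟩
  rw [hP]
  have hint : ∀ {Y : USphere d → ℝ}, Continuous Y →
      Integrable (fun ω => h ω * Y ω) (surfMeasure d) := fun hY =>
    (integrable_of_continuous hY).bdd_mul hh.aestronglyMeasurable (.of_forall hC)
  suffices H : Continuous (restrictToSphere d P) ∧
      ∫ ω, h ω * restrictToSphere d P ω ∂(surfMeasure d) = 0 from H.2
  refine Submodule.iSup_induction _ (motive := fun Y => Continuous Y ∧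
    ∫ ω, h ω * Y ω ∂(surfMeasure d) = 0) (restrictToSphere_mem_iSup hd P)
    (fun k Y hY => ⟨continuous_sphericalHarmonic hY, horth k Y hY⟩)
    ⟨continuous_zero, by simp⟩ ?_
  rintro Y Z ⟨hY, hY0⟩ ⟨hZ, hZ0⟩
  refine ⟨hY.add hZ, ?_⟩
  simp only [Pi.add_apply, mul_add]
  rw [integral_add (hint hY) (hint hZ), hY0, hZ0, add_zero]

end Completeness

/-! ### The Funk–Hecke formula -/

section FunkHecke

variable {d : ℕ}

/-- The inner product of two points of the unit sphere. -/
noncomputable def sphereInner (ω η : USphere d) : Icc (-1 : ℝ) 1 :=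
  ⟨inner ℝ (ω : Eucl d) (η : Eucl d), by
    have := abs_real_inner_le_norm (ω : Eucl d) (η : Eucl d)
    rw [mem_sphere_zero_iff_norm.1 ω.2, mem_sphere_zero_iff_norm.1 η.2, one_mul, abs_le] at this
    exact this⟩

lemma continuous_sphereInner : Continuous fun q : USphere d × USphere d => sphereInner q.1 q.2 := by
  unfold sphereInner; fun_prop

lemma sphereInner_comm (ω η : USphere d) : sphereInner ω η = sphereInner η ω :=
  Subtype.ext (real_inner_comm _ _)

lemma measurable_sphereInner (ω : USphere d) : Measurable (sphereInner ω) :=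
  (continuous_sphereInner.comp (Continuous.prodMk_right ω)).measurable

variable {κ : Icc (-1 : ℝ) 1 → ℝ}

/-- If two nonnegative continuous weights on the sphere have the same zonal moments with respect to
the poles `ω` and `ω'`, they have the same zonal integrals. -/
lemma integral_zonal_eq_of_moments_eq (hκ : Measurable κ) {φ ψ : USphere d → ℝ} (hφ : Continuous φ)
    (hψ : Continuous ψ) (hφ0 : ∀ η, 0 ≤ φ η) (hψ0 : ∀ η, 0 ≤ ψ η) {ω ω' : USphere d}
    (h : ∀ n : ℕ, ∫ η, (sphereInner ω η : ℝ) ^ n * φ η ∂(surfMeasure d) =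
      ∫ η, (sphereInner ω' η : ℝ) ^ n * ψ η ∂(surfMeasure d)) :
    ∫ η, κ (sphereInner ω η) * φ η ∂(surfMeasure d) =
      ∫ η, κ (sphereInner ω' η) * ψ η ∂(surfMeasure d) := by
  have hfin : ∀ {φ : USphere d → ℝ}, Continuous φ → IsFiniteMeasure
      ((surfMeasure d).withDensity fun η => ENNReal.ofReal (φ η)) := fun hφ =>
    isFiniteMeasure_withDensity_ofReal (integrable_of_continuous hφ).2
  have := hfin hφ
  have := hfin hψ
  have key : ∀ {φ : USphere d → ℝ} (ω : USphere d), Continuous φ → (∀ η, 0 ≤ φ η) →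
      ∀ {g : Icc (-1 : ℝ) 1 → ℝ}, Measurable g →
      ∫ t, g t ∂(((surfMeasure d).withDensity fun η => ENNReal.ofReal (φ η)).map (sphereInner ω)) =
        ∫ η, g (sphereInner ω η) * φ η ∂(surfMeasure d) := by
    intro φ ω hφ hφ0 g hg
    rw [integral_map (measurable_sphereInner ω).aemeasurable hg.aestronglyMeasurable,
      integral_withDensity_ofReal hφ.measurable hφ0]
  have heq : ((surfMeasure d).withDensity fun η => ENNReal.ofReal (φ η)).map (sphereInner ω) =
      ((surfMeasure d).withDensity fun η => ENNReal.ofReal (ψ η)).map (sphereInner ω') := by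
    refine measure_ext_of_separatesPoints (polynomialFunctions_separatesPoints _) fun g hg => ?_
    rw [key ω hφ hφ0 g.continuous.measurable, key ω' hψ hψ0 g.continuous.measurable]
    obtain ⟨P, rfl⟩ : ∃ P, Polynomial.toContinuousMapOnAlgHom (Icc (-1 : ℝ) 1) P = g := by
      rw [← SetLike.mem_coe, polynomialFunctions_coe] at hg
      exact hg
    simp only [Polynomial.toContinuousMapOnAlgHom_apply, Polynomial.toContinuousMapOn_apply,
      Polynomial.toContinuousMap_apply]
    have hint : ∀ {φ : USphere d → ℝ} (ω : USphere d), Continuous φ → ∀ P : Polynomial ℝ,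
        Integrable (fun η => P.eval (sphereInner ω η : ℝ) * φ η) (surfMeasure d) := by
      intro φ ω hφ P
      refine integrable_of_continuous (.mul ?_ hφ)
      exact P.continuous.comp (continuous_subtype_val.comp
        (continuous_sphereInner.comp (Continuous.prodMk_right ω)))
    clear hg
    induction P using Polynomial.induction_on' with
    | add p q hp hq =>
      simp only [Polynomial.eval_add, add_mul]
      rw [integral_add (hint ω hφ p) (hint ω hφ q), integral_add (hint ω' hψ p) (hint ω' hψ q),
        hp, hq]
    | monomial n a =>
      simp only [Polynomial.eval_monomial, mul_assoc]
      rw [integral_const_mul, integral_const_mul, h n]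
  rw [← key ω hφ hφ0 hκ, ← key ω' hψ hψ0 hκ, heq]

lemma one_mem_sphericalHarmonics : (fun _ => 1 : USphere d → ℝ) ∈ sphericalHarmonics d 0 :=
  mem_sphericalHarmonics.2 ⟨1, mem_harmonicPolys.2 ⟨MvPolynomial.isHomogeneous_one _ _,
    by simp [polyLaplacian_apply]⟩, by ext ω; simp [restrictToSphere]⟩

lemma integrable_zonal_mul (hκ : Measurable κ) {C : ℝ} (hC : ∀ t, |κ t| ≤ C) (ω : USphere d)
    {φ : USphere d → ℝ} (hφ : Continuous φ) :
    Integrable (fun η => κ (sphereInner ω η) * φ η) (surfMeasure d) :=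
  (integrable_of_continuous hφ).bdd_mul
    (hκ.comp (measurable_sphereInner ω)).aestronglyMeasurable (.of_forall fun _ => hC _)

/-- The Funk–Hecke formula: zonal integral operators act on spherical harmonics of a given degree
as scalars. -/
theorem exists_funkHecke (hd : 1 ≤ d) (hκ : Measurable κ) {C : ℝ} (hC : ∀ t, |κ t| ≤ C) (k : ℕ) :
    ∃ l : ℝ, ∀ Y ∈ sphericalHarmonics d k, ∀ ω : USphere d,
      ∫ η, κ (sphereInner ω η) * Y η ∂(surfMeasure d) = l * Y ω := by
  by_cases hz : ∀ Y ∈ sphericalHarmonics d k, ∀ ω, Y ω = 0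
  · exact ⟨0, fun Y hY ω => by simp [hz Y hY]⟩
  push Not at hz
  obtain ⟨Y₀, hY₀, ω₀, h₀⟩ := hz
  refine ⟨(∫ η, κ (sphereInner ω₀ η) * Y₀ η ∂(surfMeasure d)) / Y₀ ω₀, fun Y hY ω => ?_⟩
  have hYc := continuous_sphericalHarmonic hY
  have hYc₀ := continuous_sphericalHarmonic hY₀
  -- a constant making both weights `Y₀(ω₀) Y` and `Y(ω) Y₀` nonnegative
  obtain ⟨B, hB⟩ : ∃ B : ℝ, ∀ η, 0 ≤ Y₀ ω₀ * Y η + B ∧ 0 ≤ Y ω * Y₀ η + B := by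
    obtain ⟨B₁, h₁⟩ := isCompact_univ.exists_bound_of_continuousOn
      (f := fun η => Y₀ ω₀ * Y η) (by fun_prop)
    obtain ⟨B₂, h₂⟩ := isCompact_univ.exists_bound_of_continuousOn
      (f := fun η => Y ω * Y₀ η) (by fun_prop)
    refine ⟨max B₁ B₂, fun η => ⟨?_, ?_⟩⟩
    · linarith [neg_abs_le (Y₀ ω₀ * Y η), h₁ η trivial, le_max_left B₁ B₂,
        Real.norm_eq_abs (Y₀ ω₀ * Y η)]
    · linarith [neg_abs_le (Y ω * Y₀ η), h₂ η trivial, le_max_right B₁ B₂,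
        Real.norm_eq_abs (Y ω * Y₀ η)]
  have hsplit : ∀ {g : Icc (-1 : ℝ) 1 → ℝ} (_ : Measurable g) {C' : ℝ} (_ : ∀ t, |g t| ≤ C')
      (ω : USphere d) {Z : USphere d → ℝ} (_ : Continuous Z) (a : ℝ),
      ∫ η, g (sphereInner ω η) * (a * Z η + B) ∂(surfMeasure d) =
        a * ∫ η, g (sphereInner ω η) * Z η ∂(surfMeasure d) +
          B * ∫ η, g (sphereInner ω η) * 1 ∂(surfMeasure d) := by
    intro g hg C' hC' ω Z hZ a
    rw [← integral_const_mul, ← integral_const_mul, ← integral_add]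
    · congr 1 with η; ring
    · exact (integrable_zonal_mul hg hC' ω hZ).const_mul a
    · exact (integrable_zonal_mul hg hC' ω continuous_const).const_mul B
  have hpow : ∀ n : ℕ, (∀ t : Icc (-1 : ℝ) 1, |(t : ℝ) ^ n| ≤ 1) := fun n t => by
    rw [abs_pow]; exact pow_le_one₀ (abs_nonneg _) (abs_le.2 t.2)
  have hone : ∀ n : ℕ, ∫ η, (sphereInner ω η : ℝ) ^ n * 1 ∂(surfMeasure d) =
      ∫ η, (sphereInner ω₀ η : ℝ) ^ n * 1 ∂(surfMeasure d) := fun n => by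
    obtain ⟨c, hc⟩ := exists_integral_inner_pow_mul hd n 0
    exact (hc _ one_mem_sphericalHarmonics ω).trans (hc _ one_mem_sphericalHarmonics ω₀).symm
  have h1 := integral_zonal_eq_of_moments_eq hκ continuous_const continuous_const
    (fun _ => zero_le_one) (fun _ => zero_le_one) hone
  have h2 := integral_zonal_eq_of_moments_eq hκ (φ := fun η => Y₀ ω₀ * Y η + B)
    (ψ := fun η => Y ω * Y₀ η + B) (ω := ω) (ω' := ω₀) (by fun_prop) (by fun_prop)
    (fun η => (hB η).1) (fun η => (hB η).2) fun n => by
      rw [hsplit (g := fun t => (t : ℝ) ^ n) (by fun_prop) (hpow n) ω hYc,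
        hsplit (g := fun t => (t : ℝ) ^ n) (by fun_prop) (hpow n) ω₀ hYc₀, hone n]
      obtain ⟨c, hc⟩ := exists_integral_inner_pow_mul hd n k
      have e1 := hc Y hY ω
      have e2 := hc Y₀ hY₀ ω₀
      simp only [sphereInner]
      rw [e1, e2]; ring
  rw [hsplit hκ hC ω hYc, hsplit hκ hC ω₀ hYc₀, h1, add_left_inj] at h2
  rw [div_mul_eq_mul_div, eq_div_iff h₀]
  linarith

end FunkHecke

/-! ### Decay of the eigenvalues -/

section Decay

variable {d : ℕ}

/-- Bessel's inequality for an orthonormal system of functions. -/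
lemma sum_sq_integral_mul_le {X ι : Type*} [MeasurableSpace X] [DecidableEq ι] {μ : Measure X}
    {e : ι → X → ℝ} (he : ∀ i, MemLp (e i) 2 μ)
    (horth : ∀ i j, ∫ x, e i x * e j x ∂μ = if i = j then 1 else 0) {g : X → ℝ}
    (hg : MemLp g 2 μ) (s : Finset ι) :
    ∑ i ∈ s, (∫ x, g x * e i x ∂μ) ^ 2 ≤ ∫ x, g x ^ 2 ∂μ := by
  have hin : ∀ {f h : X → ℝ} (hf : MemLp f 2 μ) (hh : MemLp h 2 μ),
      inner ℝ (hf.toLp f) (hh.toLp h) = ∫ x, h x * f x ∂μ := by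
    intro f h hf hh
    rw [L2.inner_def]
    refine integral_congr_ae ?_
    filter_upwards [hf.coeFn_toLp, hh.coeFn_toLp] with x h1 h2
    simp [h1, h2]
  have ho : Orthonormal ℝ fun i => (he i).toLp (e i) := by
    rw [orthonormal_iff_ite]
    intro i j
    rw [hin, horth]
    simp [eq_comm]
  have := ho.sum_inner_products_le (s := s) (hg.toLp g)
  rw [← real_inner_self_eq_norm_sq, hin hg hg] at this
  simpa only [hin, Real.norm_eq_abs, sq_abs, ← sq] using this

lemma memLp_two_of_bounded {X : Type*} [MeasurableSpace X] {μ : Measure X} [IsFiniteMeasure μ]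
    {f : X → ℝ} (hf : Measurable f) {C : ℝ} (hC : ∀ x, |f x| ≤ C) : MemLp f 2 μ :=
  MemLp.of_bound hf.aestronglyMeasurable C (.of_forall hC)

/-- The Funk–Hecke eigenvalues of a bounded profile tend to zero along the degrees carrying nonzero
harmonics. -/
theorem finite_setOf_le_abs_funkHecke (hd : 1 ≤ d) {κ : Icc (-1 : ℝ) 1 → ℝ} (hκ : Measurable κ)
    {C : ℝ} (hC : ∀ t, |κ t| ≤ C) {lam : ℕ → ℝ}
    (hlam : ∀ k, ∀ Y ∈ sphericalHarmonics d k, ∀ ω : USphere d,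
      ∫ η, κ (sphereInner ω η) * Y η ∂(surfMeasure d) = lam k * Y ω) {ε : ℝ} (hε : 0 < ε) :
    {k | (∃ Z ∈ sphericalHarmonics d k, ∫ ω, Z ω * Z ω ∂(surfMeasure d) = 1) ∧
      ε ≤ |lam k|}.Finite := by
  classical
  set S := {k | (∃ Z ∈ sphericalHarmonics d k, ∫ ω, Z ω * Z ω ∂(surfMeasure d) = 1) ∧
    ε ≤ |lam k|}
  by_contra hS
  have : Infinite S := Set.infinite_coe_iff.2 hS
  choose Z hZ hZ1 using fun k : S => k.2.1
  have hZc := fun k => continuous_sphericalHarmonic (hZ k)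
  have hZ2 : ∀ k, MemLp (Z k) 2 (surfMeasure d) := fun k => by
    obtain ⟨B, hB⟩ := isCompact_univ.exists_bound_of_continuousOn (hZc k).continuousOn
    exact memLp_two_of_bounded (hZc k).measurable fun x => hB x trivial
  set V := (surfMeasure d).real univ
  -- `n` degrees with `|λ_k| ≥ ε` force `n ε² ≤ ∫∫ κ(ωᵀη)² ≤ C² V²`
  obtain ⟨n, hn⟩ := exists_nat_gt (C ^ 2 * V * V / ε ^ 2)
  obtain ⟨s, hs⟩ := Infinite.exists_subset_card_eq S n
  have hpt : ∀ ω, ∑ k ∈ s, lam k ^ 2 * (Z k ω * Z k ω) ≤ C ^ 2 * V := by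
    intro ω
    have hm := hκ.comp (measurable_sphereInner ω)
    have hb : ∀ η, |(κ ∘ sphereInner ω) η| ≤ C := fun η => hC _
    have h1 := sum_sq_integral_mul_le hZ2 (fun i j => by
      split_ifs with h
      · rw [h, hZ1]
      · exact integral_sphericalHarmonics_mul_eq_zero hd (fun h' => h (Subtype.ext h')) (hZ i)
          (hZ j)) (memLp_two_of_bounded hm hb) s
    have h2 : ∫ η, (κ ∘ sphereInner ω) η ^ 2 ∂(surfMeasure d) ≤ ∫ _, C ^ 2 ∂(surfMeasure d) :=
      integral_mono (memLp_two_of_bounded hm hb).integrable_sq (integrable_const _)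
        fun η => sq_le_sq' (abs_le.1 (hb η)).1 (abs_le.1 (hb η)).2
    rw [integral_const, smul_eq_mul] at h2
    calc _ = ∑ k ∈ s, (∫ η, (κ ∘ sphereInner ω) η * Z k η ∂(surfMeasure d)) ^ 2 :=
          Finset.sum_congr rfl fun k _ => by
            simp only [Function.comp_apply, hlam k (Z k) (hZ k) ω]; ring
      _ ≤ C ^ 2 * V := by linarith
  have hint : ∀ k : S, Integrable (fun ω => lam k ^ 2 * (Z k ω * Z k ω)) (surfMeasure d) := fun k =>
    integrable_of_continuous (by have := hZc k; fun_prop)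
  have h3 : ∫ ω, ∑ k ∈ s, lam k ^ 2 * (Z k ω * Z k ω) ∂(surfMeasure d) ≤
      ∫ _, C ^ 2 * V ∂(surfMeasure d) :=
    integral_mono (integrable_finsetSum _ fun k _ => hint k) (integrable_const _) hpt
  rw [integral_finsetSum _ fun k _ => hint k, integral_const, smul_eq_mul] at h3
  simp_rw [integral_const_mul, hZ1, mul_one] at h3
  have h4 : n * ε ^ 2 ≤ ∑ k ∈ s, lam k ^ 2 := by
    rw [← hs, ← nsmul_eq_mul]
    refine Finset.card_nsmul_le_sum _ _ _ fun k _ => ?_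
    rw [← sq_abs (lam k)]
    exact pow_le_pow_left₀ hε.le k.2.2 2
  rw [div_lt_iff₀ (by positivity)] at hn
  have : V * (C ^ 2 * V) = C ^ 2 * V * V := by ring
  linarith

end Decay

/-! ### The radial law and its moments -/

section Radial

variable {d : ℕ} {p : ℝ → ℝ}

lemma surfMeasure_real_univ_pos (hd : 1 ≤ d) : 0 < (surfMeasure d).real univ := by
  have := eucl_nontrivial hd
  have h : surfMeasure d ≠ 0 := Measure.toSphere_ne_zero _
  rw [measureReal_def, ENNReal.toReal_pos_iff]
  exact ⟨pos_iff_ne_zero.2 (Measure.measure_univ_ne_zero.2 h), measure_lt_top _ _⟩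

/-- The radial part of `radialMeasure d p`: the measure `p(r) dr / A(1)` on `(0, ∞)`. -/
noncomputable def radialLaw (d : ℕ) (p : ℝ → ℝ) : Measure (Ioi (0 : ℝ)) :=
  radialPart d fun r => p r / sphereArea d r

instance : SFinite (radialLaw d p) := by unfold radialLaw; infer_instance

lemma sphereArea_nonneg {r : ℝ} (hr : 0 ≤ r) : 0 ≤ sphereArea d r :=
  mul_nonneg (pow_nonneg hr _) measureReal_nonneg

lemma measurable_radialWeight (hp : IsRadialDensity p) :
    Measurable fun r => p r / sphereArea d r := by
  have := hp.measurable
  unfold sphereArea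
  fun_prop

lemma radialWeight_nonneg (hp : IsRadialDensity p) (r : ℝ) (hr : 0 < r) :
    0 ≤ p r / sphereArea d r :=
  div_nonneg (hp.nonneg r hr.le) (sphereArea_nonneg hr.le)

lemma radialMeasure_eq_map_polarMap (hd : 1 ≤ d) (hp : IsRadialDensity p) :
    radialMeasure d p = ((surfMeasure d).prod (radialLaw d p)).map (polarMap d) := by
  rw [radialLaw, ← withDensity_norm_eq_map_polarMap hd (measurable_radialWeight hp), radialMeasure]

lemma pow_mul_radialWeight {r : ℝ} (hr : 0 < r) (y : ℝ) :
    r ^ (d - 1) * (p r / sphereArea d r) * y = ((surfMeasure d).real univ)⁻¹ * (p r * y) := by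
  have : r ^ (d - 1) ≠ 0 := (pow_pos hr _).ne'
  rw [sphereArea]
  field_simp

lemma integrable_radialLaw (hp : IsRadialDensity p) {f : ℝ → ℝ}
    (hf : IntegrableOn (fun r => p r * f r) (Ioi 0)) :
    Integrable (fun r : Ioi (0 : ℝ) => f r) (radialLaw d p) := by
  rw [radialLaw, integrable_radialPart_iff (measurable_radialWeight hp) (radialWeight_nonneg hp)]
  exact IntegrableOn.congr_fun (hf.const_mul ((surfMeasure d).real univ)⁻¹)
    (fun r hr => (pow_mul_radialWeight hr _).symm) measurableSet_Ioi

lemma integral_radialLaw (hp : IsRadialDensity p) (f : ℝ → ℝ) :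
    ∫ r : Ioi (0 : ℝ), f r ∂(radialLaw d p) =
      ((surfMeasure d).real univ)⁻¹ * ∫ r in Ioi 0, p r * f r := by
  rw [radialLaw, integral_radialPart (measurable_radialWeight hp) (radialWeight_nonneg hp),
    ← integral_const_mul]
  exact setIntegral_congr_fun measurableSet_Ioi fun r hr => pow_mul_radialWeight hr _

lemma isFiniteMeasure_radialLaw (hp : IsRadialDensity p) : IsFiniteMeasure (radialLaw d p) := by
  have := integrable_radialLaw (d := d) hp (f := fun _ => 1) (by simpa using hp.integrable)
  exact (integrable_const_iff_isFiniteMeasure one_ne_zero).1 this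

lemma memLp_radius (hp : IsRadialDensity p) :
    MemLp (fun r : Ioi (0 : ℝ) => (r : ℝ)) 2 (radialLaw d p) := by
  rw [memLp_two_iff_integrable_sq (by fun_prop)]
  exact integrable_radialLaw hp (f := fun r => r ^ 2) hp.integrable_sq

lemma memLp_affine (hp : IsRadialDensity p) (a b : ℝ) :
    MemLp (fun r : Ioi (0 : ℝ) => a * (r : ℝ) + b) 2 (radialLaw d p) := by
  have := isFiniteMeasure_radialLaw (d := d) hp
  exact ((memLp_radius hp).const_mul a).add (memLp_const b)

lemma integrable_affine (hp : IsRadialDensity p) (a b : ℝ) :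
    Integrable (fun r : Ioi (0 : ℝ) => a * (r : ℝ) + b) (radialLaw d p) := by
  have := isFiniteMeasure_radialLaw (d := d) hp
  exact (memLp_affine hp a b).integrable (by norm_num)

lemma integrable_affine_mul_affine (hp : IsRadialDensity p) (a b a' b' : ℝ) :
    Integrable (fun r : Ioi (0 : ℝ) => (a * (r : ℝ) + b) * (a' * (r : ℝ) + b')) (radialLaw d p) :=
  (memLp_affine hp a b).integrable_mul (memLp_affine hp a' b')

lemma radialMoment_eq (hd : 1 ≤ d) (hp : IsRadialDensity p) (q : ℕ) :
    radialMoment d p q = ∫ r : Ioi (0 : ℝ), (r : ℝ) ^ q ∂(radialLaw d p) := by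
  rw [radialLaw, integral_radialPart (measurable_radialWeight hp) (radialWeight_nonneg hp)
    fun r => r ^ q, radialMoment]
  congr 1 with r
  rw [show q + d - 1 = (d - 1) + q by omega, pow_add]
  ring

lemma integral_affine_mul_affine (hd : 1 ≤ d) (hp : IsRadialDensity p) (a b a' b' : ℝ) :
    ∫ r : Ioi (0 : ℝ), (a * (r : ℝ) + b) * (a' * (r : ℝ) + b') ∂(radialLaw d p) =
      a * (radialMoment d p 2 * a' + radialMoment d p 1 * b') +
        b * (radialMoment d p 1 * a' + radialMoment d p 0 * b') := by
  have := isFiniteMeasure_radialLaw (d := d) hp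
  have h2 : Integrable (fun r : Ioi (0 : ℝ) => (r : ℝ) ^ 2) (radialLaw d p) :=
    (memLp_radius hp).integrable_sq
  have h1 : Integrable (fun r : Ioi (0 : ℝ) => (r : ℝ) ^ 1) (radialLaw d p) := by
    simpa using (memLp_radius (d := d) hp).integrable (by norm_num)
  have h0 : Integrable (fun r : Ioi (0 : ℝ) => (r : ℝ) ^ 0) (radialLaw d p) := by simp
  have : ∀ r : Ioi (0 : ℝ), (a * (r : ℝ) + b) * (a' * (r : ℝ) + b') =
      a * a' * (r : ℝ) ^ 2 + (a * b' + b * a') * (r : ℝ) ^ 1 + b * b' * (r : ℝ) ^ 0 :=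
    fun r => by ring
  simp_rw [this]
  have h21 : Integrable (fun r : Ioi (0 : ℝ) => a * a' * (r : ℝ) ^ 2 +
    (a * b' + b * a') * (r : ℝ) ^ 1) (radialLaw d p) := (h2.const_mul _).add (h1.const_mul _)
  rw [integral_add h21 (h0.const_mul _), integral_add (h2.const_mul _) (h1.const_mul _),
    integral_const_mul, integral_const_mul, integral_const_mul, radialMoment_eq hd hp,
    radialMoment_eq hd hp, radialMoment_eq hd hp]
  ring

lemma integral_affine (hd : 1 ≤ d) (hp : IsRadialDensity p) (a b : ℝ) :
    ∫ r : Ioi (0 : ℝ), (a * (r : ℝ) + b) ∂(radialLaw d p) =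
      radialMoment d p 1 * a + radialMoment d p 0 * b := by
  simpa using integral_affine_mul_affine hd hp 0 1 a b

/-- The moment matrix is positive definite, as the radial law has no atoms. -/
lemma momentForm_pos (hd : 1 ≤ d) (hp : IsRadialDensity p) {a b : ℝ} (hab : a ≠ 0 ∨ b ≠ 0) :
    0 < a * (radialMoment d p 2 * a + radialMoment d p 1 * b) +
        b * (radialMoment d p 1 * a + radialMoment d p 0 * b) := by
  rw [← integral_affine_mul_affine hd hp,
    integral_radialLaw hp fun r => (a * r + b) * (a * r + b)]
  have hS := surfMeasure_real_univ_pos hd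
  refine mul_pos (inv_pos.2 hS) ?_
  have hnn : ∀ r ∈ Ioi (0 : ℝ), 0 ≤ p r * ((a * r + b) * (a * r + b)) := fun r hr =>
    mul_nonneg (hp.nonneg r (le_of_lt hr)) (mul_self_nonneg _)
  refine lt_of_le_of_ne (setIntegral_nonneg measurableSet_Ioi hnn) fun h0 => ?_
  have hint : IntegrableOn (fun r => p r * ((a * r + b) * (a * r + b))) (Ioi 0) := by
    have h := integrable_affine_mul_affine (d := d) hp a b a b
    rw [radialLaw, integrable_radialPart_iff (measurable_radialWeight hp) (radialWeight_nonneg hp)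
      fun r => (a * r + b) * (a * r + b)] at h
    refine IntegrableOn.congr_fun (h.const_mul ((surfMeasure d).real univ)) (fun r hr => ?_)
      measurableSet_Ioi
    simp only [pow_mul_radialWeight hr]
    rw [mul_inv_cancel_left₀ hS.ne']
  have hae := (setIntegral_eq_zero_iff_of_nonneg_ae
    ((ae_restrict_mem measurableSet_Ioi).mono hnn) hint).1 h0.symm
  have hne : ∀ᵐ r : ℝ, a * r + b ≠ 0 := by
    rw [ae_iff]
    refine measure_mono_null (t := {-b / a}) (fun r hr => ?_) (measure_singleton _)
    simp only [not_not, mem_ofPred_eq] at hr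
    have ha : a ≠ 0 := fun ha => hab.elim (fun h => h ha) fun h => h (by simpa [ha] using hr)
    rw [mem_singleton_iff, eq_div_iff ha]
    linarith
  have hp0 : ∫ r in Ioi 0, p r * r ^ 2 = 0 := by
    rw [integral_congr_ae (g := fun _ => (0 : ℝ)), integral_zero]
    filter_upwards [hae, ae_restrict_of_ae hne] with r h1 h2
    have : p r = 0 := by simpa [h2] using h1
    simp [this]
  exact hp.pos_sq.ne' hp0

lemma momentAction_mulVec (l m : ℝ) (v : Fin 2 → ℝ) :
    (momentAction d p l m).mulVec v = ![l * (radialMoment d p 2 * v 0 + radialMoment d p 1 * v 1),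
      m * (radialMoment d p 1 * v 0 + radialMoment d p 0 * v 1)] := by
  ext i
  fin_cases i <;> simp [momentAction, Matrix.mulVec, dotProduct, Fin.sum_univ_two] <;> ring

end Radial

/-! ### Functions and kernels in polar coordinates -/

section PolarFunctions

variable {d : ℕ} {p : ℝ → ℝ}

lemma affineHarmonic_polarMap (v : Fin 2 → ℝ) (Y : USphere d → ℝ) (q : USphere d × Ioi (0 : ℝ)) :
    affineHarmonic v Y (polarMap d q) = (v 0 * q.2 + v 1) * Y q.1 := by
  rw [affineHarmonic, dif_neg (polarMap_ne_zero q)]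
  simp only [norm_polarMap]
  congr 2
  ext1
  simp [polarMap, inv_smul_smul₀ (ne_of_gt q.2.2.out)]

lemma kernel_polarMap {k₀ k₁ : Eucl d → Eucl d → ℝ} {κ₀ κ₁ : ℝ → ℝ}
    (hk₀ : IsHomogeneousKernel 1 k₀ κ₀) (hk₁ : IsHomogeneousKernel 0 k₁ κ₁)
    (q q' : USphere d × Ioi (0 : ℝ)) :
    k₀ (polarMap d q) (polarMap d q') + k₁ (polarMap d q) (polarMap d q') =
      q.2 * q'.2 * κ₀ (sphereInner q.1 q'.1) + κ₁ (sphereInner q.1 q'.1) := by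
  have h1 : (q.2 : ℝ) ≠ 0 := ne_of_gt q.2.2.out
  have h2 : (q'.2 : ℝ) ≠ 0 := ne_of_gt q'.2.2.out
  have h3 : inner ℝ (polarMap d q) (polarMap d q') / (‖polarMap d q‖ * ‖polarMap d q'‖) =
      (sphereInner q.1 q'.1 : ℝ) := by
    rw [norm_polarMap, norm_polarMap]
    simp only [polarMap, inner_smul_left, inner_smul_right, sphereInner, conj_trivial]
    field_simp
  rw [hk₀.eq _ _ (polarMap_ne_zero q) (polarMap_ne_zero q'),
    hk₁.eq _ _ (polarMap_ne_zero q) (polarMap_ne_zero q'), h3, norm_polarMap, norm_polarMap]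
  simp

/-- The kernel `r r' κ₀(ωᵀη) + κ₁(ωᵀη)` maps `(α r + β) Y` to a function of the same form. -/
lemma integral_polarKernel_mul_affine (hd : 1 ≤ d) (hp : IsRadialDensity p)
    {κ₀ κ₁ : Icc (-1 : ℝ) 1 → ℝ} (hκ₀ : Measurable κ₀) (hκ₁ : Measurable κ₁) {C₀ C₁ : ℝ}
    (hC₀ : ∀ t, |κ₀ t| ≤ C₀) (hC₁ : ∀ t, |κ₁ t| ≤ C₁) {Y : USphere d → ℝ} (hY : Continuous Y)
    {l m : ℝ} (hl : ∀ ω, ∫ η, κ₀ (sphereInner ω η) * Y η ∂(surfMeasure d) = l * Y ω)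
    (hm : ∀ ω, ∫ η, κ₁ (sphereInner ω η) * Y η ∂(surfMeasure d) = m * Y ω) (v : Fin 2 → ℝ)
    (q : USphere d × Ioi (0 : ℝ)) :
    Integrable (fun q' : USphere d × Ioi (0 : ℝ) =>
      (q.2 * q'.2 * κ₀ (sphereInner q.1 q'.1) + κ₁ (sphereInner q.1 q'.1)) *
        ((v 0 * q'.2 + v 1) * Y q'.1)) ((surfMeasure d).prod (radialLaw d p)) ∧
    ∫ q' : USphere d × Ioi (0 : ℝ),
      (q.2 * q'.2 * κ₀ (sphereInner q.1 q'.1) + κ₁ (sphereInner q.1 q'.1)) *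
        ((v 0 * q'.2 + v 1) * Y q'.1) ∂((surfMeasure d).prod (radialLaw d p)) =
      (((momentAction d p l m).mulVec v) 0 * q.2 + ((momentAction d p l m).mulVec v) 1) *
        Y q.1 := by
  have e : ∀ q' : USphere d × Ioi (0 : ℝ),
      (q.2 * q'.2 * κ₀ (sphereInner q.1 q'.1) + κ₁ (sphereInner q.1 q'.1)) *
        ((v 0 * q'.2 + v 1) * Y q'.1) =
      (κ₀ (sphereInner q.1 q'.1) * Y q'.1) * ((q.2 * q'.2 + 0) * (v 0 * q'.2 + v 1)) +
        (κ₁ (sphereInner q.1 q'.1) * Y q'.1) * (v 0 * q'.2 + v 1) := fun q' => by ring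
  simp_rw [e]
  have i₀ := (integrable_zonal_mul hκ₀ hC₀ q.1 hY).mul_prod
    (integrable_affine_mul_affine (d := d) hp q.2 0 (v 0) (v 1))
  have i₁ := (integrable_zonal_mul hκ₁ hC₁ q.1 hY).mul_prod
    (integrable_affine (d := d) hp (v 0) (v 1))
  refine ⟨i₀.add i₁, ?_⟩
  rw [integral_add i₀ i₁,
    integral_prod_mul (fun η => κ₀ (sphereInner q.1 η) * Y η)
      fun r : Ioi (0 : ℝ) => (q.2 * (r : ℝ) + 0) * (v 0 * (r : ℝ) + v 1),
    integral_prod_mul (fun η => κ₁ (sphereInner q.1 η) * Y η)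
      fun r : Ioi (0 : ℝ) => v 0 * (r : ℝ) + v 1, hl, hm, integral_affine_mul_affine hd hp,
    integral_affine hd hp, momentAction_mulVec]
  simp only [Matrix.cons_val_zero, Matrix.cons_val_one]
  ring

lemma integral_affineHarmonic_mul (hd : 1 ≤ d) (hp : IsRadialDensity p) (v w : Fin 2 → ℝ)
    (Y Z : USphere d → ℝ) :
    ∫ x, affineHarmonic v Y x * affineHarmonic w Z x ∂(radialMeasure d p) =
      (v 0 * (radialMoment d p 2 * w 0 + radialMoment d p 1 * w 1) +
        v 1 * (radialMoment d p 1 * w 0 + radialMoment d p 0 * w 1)) *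
      ∫ ω, Y ω * Z ω ∂(surfMeasure d) := by
  rw [radialMeasure_eq_map_polarMap hd hp, measurableEmbedding_polarMap.integral_map]
  simp_rw [affineHarmonic_polarMap]
  rw [← integral_affine_mul_affine hd hp, mul_comm,
    ← integral_prod_mul (fun ω => Y ω * Z ω)
      fun r : Ioi (0 : ℝ) => (v 0 * (r : ℝ) + v 1) * (w 0 * (r : ℝ) + w 1)]
  congr 1 with q
  ring

lemma memLp_affineHarmonic (hd : 1 ≤ d) (hp : IsRadialDensity p) (v : Fin 2 → ℝ)
    {Y : USphere d → ℝ} (hY : Continuous Y) :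
    MemLp (affineHarmonic v Y) 2 (radialMeasure d p) := by
  rw [radialMeasure_eq_map_polarMap hd hp, measurableEmbedding_polarMap.memLp_map_measure_iff]
  have e : affineHarmonic v Y ∘ polarMap d = fun q => (v 0 * q.2 + v 1) * Y q.1 :=
    funext fun q => affineHarmonic_polarMap v Y q
  have hYm := hY.measurable
  rw [e, memLp_two_iff_integrable_sq (by fun_prop)]
  have e2 : ∀ q : USphere d × Ioi (0 : ℝ), ((v 0 * q.2 + v 1) * Y q.1) ^ 2 =
      Y q.1 ^ 2 * (v 0 * q.2 + v 1) ^ 2 := fun q => by ring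
  simp_rw [e2]
  exact (integrable_of_continuous (hY.pow 2)).mul_prod (memLp_affine hp _ _).integrable_sq

end PolarFunctions

/-! ### Eigenfunctions -/

section Eigenfunctions

variable {d : ℕ} {p : ℝ → ℝ}

/-- The function `ω ↦ ∫ κ(ωᵀη) G(η, r)` on the sphere. -/
noncomputable def zonalTransform (τ : Measure (USphere d × Ioi (0 : ℝ)))
    (κ : Icc (-1 : ℝ) 1 → ℝ) (G : USphere d × Ioi (0 : ℝ) → ℝ) (ω : USphere d) : ℝ :=
  ∫ q, κ (sphereInner ω q.1) * G q ∂τ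

variable {τ : Measure (USphere d × Ioi (0 : ℝ))} {κ : Icc (-1 : ℝ) 1 → ℝ}
  {G : USphere d × Ioi (0 : ℝ) → ℝ}

lemma measurable_zonalTransform [SFinite τ] (hκ : Measurable κ) (hG : Measurable G) :
    Measurable (zonalTransform τ κ G) := by
  have h : Measurable fun z : USphere d × (USphere d × Ioi (0 : ℝ)) =>
      κ (sphereInner z.1 z.2.1) * G z.2 := by
    refine (hκ.comp ?_).mul (hG.comp measurable_snd)
    exact (continuous_sphereInner.comp (continuous_fst.prodMk continuous_snd.fst)).measurable
  exact h.stronglyMeasurable.integral_prod_right.measurable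

lemma integrable_zonal_mul_prod (hκ : Measurable κ) {C : ℝ} (hC : ∀ t, |κ t| ≤ C)
    (hG : Integrable G τ) (ω : USphere d) :
    Integrable (fun q => κ (sphereInner ω q.1) * G q) τ :=
  hG.bdd_mul (hκ.comp ((measurable_sphereInner ω).comp measurable_fst)).aestronglyMeasurable
    (.of_forall fun _ => hC _)

lemma abs_zonalTransform_le {C : ℝ} (hC : ∀ t, |κ t| ≤ C)
    (hG : Integrable G τ) (ω : USphere d) : |zonalTransform τ κ G ω| ≤ C * ∫ q, |G q| ∂τ := by
  rw [zonalTransform, ← integral_const_mul]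
  refine norm_integral_le_of_norm_le (f := fun q => κ (sphereInner ω q.1) * G q)
    (hG.abs.const_mul C) (.of_forall fun q => ?_)
  rw [Real.norm_eq_abs, abs_mul]
  exact mul_le_mul_of_nonneg_right (hC _) (abs_nonneg _)

/-- By Fubini and the symmetry of zonal kernels, the coefficients of a zonal transform are obtained
from the Funk–Hecke formula. -/
lemma integral_zonalTransform_mul [SFinite τ] (hκ : Measurable κ) {C : ℝ} (hC : ∀ t, |κ t| ≤ C)
    (hG : Integrable G τ) {Y : USphere d → ℝ} (hY : Continuous Y) {l : ℝ}
    (hl : ∀ ω, ∫ η, κ (sphereInner ω η) * Y η ∂(surfMeasure d) = l * Y ω) :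
    ∫ ω, zonalTransform τ κ G ω * Y ω ∂(surfMeasure d) = l * ∫ q, G q * Y q.1 ∂τ := by
  have hm : Measurable fun z : USphere d × (USphere d × Ioi (0 : ℝ)) =>
      κ (sphereInner z.1 z.2.1) :=
    hκ.comp (continuous_sphereInner.comp (continuous_fst.prodMk continuous_snd.fst)).measurable
  have hint : Integrable (Function.uncurry fun ω q => κ (sphereInner ω q.1) * G q * Y ω)
      ((surfMeasure d).prod τ) := by
    have := ((integrable_of_continuous (μ := surfMeasure d) hY).mul_prod hG).bdd_mul (c := C)
      hm.aestronglyMeasurable (.of_forall fun _ => hC _)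
    refine this.congr (.of_forall fun z => ?_)
    simp only [Function.uncurry]
    ring
  simp_rw [zonalTransform, ← integral_mul_const]
  rw [integral_integral_swap hint, ← integral_const_mul]
  congr 1 with q
  have : ∀ ω, κ (sphereInner ω q.1) * G q * Y ω = G q * (κ (sphereInner q.1 ω) * Y ω) :=
    fun ω => by rw [sphereInner_comm]; ring
  simp_rw [this]
  rw [integral_const_mul, hl]
  ring

/-- A bounded function with finitely many degrees in its harmonic expansion equals this expansion
almost everywhere. -/
lemma ae_eq_sum_harmonics (hd : 1 ≤ d) {Y : (k : ℕ) → Fin (numHarmonics d k) → USphere d → ℝ}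
    (hY : IsHarmonicBasis d Y) {g : USphere d → ℝ} (hg : Measurable g) {C : ℝ}
    (hC : ∀ ω, |g ω| ≤ C) (K : Finset ℕ)
    (hK : ∀ k ∉ K, ∀ j, ∫ ω, g ω * Y k j ω ∂(surfMeasure d) = 0) :
    g =ᵐ[surfMeasure d] fun ω =>
      ∑ k ∈ K, ∑ j, (∫ η, g η * Y k j η ∂(surfMeasure d)) * Y k j ω := by
  have hmem : ∀ k j, Y k j ∈ sphericalHarmonics d k := fun k j => by
    rw [← hY.span_eq k]; exact Submodule.subset_span ⟨j, rfl⟩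
  have hYc : ∀ k j, Continuous (Y k j) := fun k j => continuous_sphericalHarmonic (hmem k j)
  set P : USphere d → ℝ := fun ω =>
    ∑ k ∈ K, ∑ j, (∫ η, g η * Y k j η ∂(surfMeasure d)) * Y k j ω with hP
  have hPc : Continuous P := by
    refine continuous_finsetSum _ fun k _ => continuous_finsetSum _ fun j _ => ?_
    exact continuous_const.mul (hYc k j)
  obtain ⟨B, hB⟩ := isCompact_univ.exists_bound_of_continuousOn hPc.continuousOn
  have hb : ∀ ω, |g ω - P ω| ≤ C + B := fun ω =>
    (abs_sub _ _).trans (add_le_add (hC ω) (hB ω trivial))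
  have hm : Measurable fun ω => g ω - P ω := hg.sub hPc.measurable
  have hgi : ∀ {Z : USphere d → ℝ}, Continuous Z →
      Integrable (fun ω => g ω * Z ω) (surfMeasure d) := fun hZ =>
    (integrable_of_continuous hZ).bdd_mul hg.aestronglyMeasurable (.of_forall hC)
  have hdi : ∀ {Z : USphere d → ℝ}, Continuous Z →
      Integrable (fun ω => (g ω - P ω) * Z ω) (surfMeasure d) := fun hZ =>
    (integrable_of_continuous hZ).bdd_mul hm.aestronglyMeasurable (.of_forall hb)
  have key : ∀ l i, ∫ ω, (g ω - P ω) * Y l i ω ∂(surfMeasure d) = 0 := by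
    intro l i
    have hPl : ∫ ω, P ω * Y l i ω ∂(surfMeasure d) =
        ∑ k ∈ K, ∑ j, (∫ η, g η * Y k j η ∂(surfMeasure d)) *
          ∫ ω, Y k j ω * Y l i ω ∂(surfMeasure d) := by
      simp_rw [hP, Finset.sum_mul, mul_assoc]
      have hi : ∀ k j, Integrable (fun ω => (∫ η, g η * Y k j η ∂(surfMeasure d)) *
          (Y k j ω * Y l i ω)) (surfMeasure d) := fun k j =>
        (integrable_of_continuous ((hYc k j).mul (hYc l i))).const_mul _
      rw [integral_finsetSum _ fun k _ => integrable_finsetSum _ fun j _ => hi k j]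
      refine Finset.sum_congr rfl fun k _ => ?_
      rw [integral_finsetSum _ fun j _ => hi k j]
      exact Finset.sum_congr rfl fun j _ => integral_const_mul _ _
    have hk : ∀ k, k ≠ l → ∑ j, (∫ η, g η * Y k j η ∂(surfMeasure d)) *
          ∫ ω, Y k j ω * Y l i ω ∂(surfMeasure d) = 0 := fun k hkl =>
      Finset.sum_eq_zero fun j _ => by
        rw [integral_sphericalHarmonics_mul_eq_zero hd hkl (hmem k j) (hmem l i), mul_zero]
    have hl : ∑ j, (∫ η, g η * Y l j η ∂(surfMeasure d)) *
          ∫ ω, Y l j ω * Y l i ω ∂(surfMeasure d) = ∫ η, g η * Y l i η ∂(surfMeasure d) := by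
      simp [hY.orthonormal]
    have hsub : ∀ ω, (g ω - P ω) * Y l i ω = g ω * Y l i ω - P ω * Y l i ω :=
      fun ω => sub_mul _ _ _
    simp_rw [hsub]
    have hPi : Integrable (fun ω => P ω * Y l i ω) (surfMeasure d) :=
      integrable_of_continuous (hPc.mul (hYc l i))
    rw [integral_sub (hgi (hYc l i)) hPi, hPl]
    by_cases hlK : l ∈ K
    · rw [Finset.sum_eq_single_of_mem l hlK fun k _ hkl => hk k hkl, hl, sub_self]
    · rw [Finset.sum_eq_zero fun k hkK => hk k fun h => hlK (h ▸ hkK), hK l hlK, sub_zero]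
  have h0 := ae_eq_zero_of_orthogonal_sphericalHarmonics hd hm hb fun k Z hZ => by
    suffices H : Continuous Z ∧ ∫ ω, (g ω - P ω) * Z ω ∂(surfMeasure d) = 0 from H.2
    rw [← hY.span_eq k] at hZ
    induction hZ using Submodule.span_induction with
    | mem Z hZ => obtain ⟨j, rfl⟩ := hZ; exact ⟨hYc k j, key k j⟩
    | zero => exact ⟨continuous_zero, by simp⟩
    | add Z W _ _ hZ hW =>
      refine ⟨hZ.1.add hW.1, ?_⟩
      simp only [Pi.add_apply, mul_add]
      rw [integral_add (hdi hZ.1) (hdi hW.1), hZ.2, hW.2, add_zero]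
    | smul a Z _ hZ =>
      refine ⟨hZ.1.const_smul a, ?_⟩
      have : ∀ ω, (g ω - P ω) * (a • Z) ω = a * ((g ω - P ω) * Z ω) := fun ω => by
        rw [Pi.smul_apply, smul_eq_mul]; ring
      simp_rw [this]
      rw [integral_const_mul, hZ.2, mul_zero]
  filter_upwards [h0] with ω hω
  exact sub_eq_zero.1 hω

end Eigenfunctions

/-! ### Expansion of eigenfunctions into spherical harmonics -/

section Expansion

variable {d : ℕ} {p : ℝ → ℝ}

lemma harmonicBasis_mem {Y : (k : ℕ) → Fin (numHarmonics d k) → USphere d → ℝ}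
    (hY : IsHarmonicBasis d Y) (k : ℕ) (j : Fin (numHarmonics d k)) :
    Y k j ∈ sphericalHarmonics d k := by
  rw [← hY.span_eq k]
  exact Submodule.subset_span ⟨j, rfl⟩

/-- An eigenvalue of `diag(l, m) * M` with `M` the moment matrix is small if `l` and `m` are. -/
lemma eq_zero_of_momentAction_mulVec_eq {l m c : ℝ} (hc : c ≠ 0)
    (hl : |l| < |c| / (1 + |radialMoment d p 2| + 2 * |radialMoment d p 1| + |radialMoment d p 0|))
    (hm : |m| < |c| / (1 + |radialMoment d p 2| + 2 * |radialMoment d p 1| + |radialMoment d p 0|))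
    {u : Fin 2 → ℝ} (hu : (momentAction d p l m).mulVec u = c • u) : u = 0 := by
  set M₂ := radialMoment d p 2
  set M₁ := radialMoment d p 1
  set M₀ := radialMoment d p 0
  set ε := |c| / (1 + |M₂| + 2 * |M₁| + |M₀|) with hε
  have hden : 0 < 1 + |M₂| + 2 * |M₁| + |M₀| := by positivity
  have hεc : ε * (1 + |M₂| + 2 * |M₁| + |M₀|) = |c| := div_mul_cancel₀ _ hden.ne'
  have hε0 : 0 < ε := div_pos (abs_pos.2 hc) hden
  rw [momentAction_mulVec] at hu
  have e0 : c * u 0 = l * (M₂ * u 0 + M₁ * u 1) := by simpa using (congrFun hu 0).symm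
  have e1 : c * u 1 = m * (M₁ * u 0 + M₀ * u 1) := by simpa using (congrFun hu 1).symm
  have b0 : |c| * |u 0| ≤ ε * (|M₂| * |u 0| + |M₁| * |u 1|) := by
    rw [← abs_mul, e0, abs_mul]
    refine mul_le_mul hl.le ?_ (abs_nonneg _) hε0.le
    rw [← abs_mul, ← abs_mul]
    exact abs_add_le _ _
  have b1 : |c| * |u 1| ≤ ε * (|M₁| * |u 0| + |M₀| * |u 1|) := by
    rw [← abs_mul, e1, abs_mul]
    refine mul_le_mul hm.le ?_ (abs_nonneg _) hε0.le
    rw [← abs_mul, ← abs_mul]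
    exact abs_add_le _ _
  have hs : ε * (|u 0| + |u 1|) ≤ 0 := by
    have n1 : 0 ≤ ε * (|M₁| * |u 0|) := by positivity
    have n2 : 0 ≤ ε * (|M₁| * |u 1|) := by positivity
    have n3 : 0 ≤ ε * (|M₀| * |u 0|) := by positivity
    have n4 : 0 ≤ ε * (|M₂| * |u 1|) := by positivity
    rw [← hεc] at b0 b1
    linarith
  have h0 : |u 0| + |u 1| ≤ 0 := nonpos_of_mul_nonpos_right hs hε0
  have a0 := abs_nonneg (u 0)
  have a1 := abs_nonneg (u 1)
  ext i
  fin_cases i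
  · exact abs_eq_zero.1 (show |u 0| = 0 by linarith)
  · exact abs_eq_zero.1 (show |u 1| = 0 by linarith)

/-- An eigenfunction of the kernel `r r' κ₀(ωᵀη) + κ₁(ωᵀη)` with a nonzero eigenvalue `c` is a
finite sum of functions `(α r + β) Y`, where `(α, β)` is in the eigenspace for `c` of the
matrix belonging to the degree of `Y`. -/
theorem polar_eigenfunction_ae_eq_sum (hd : 1 ≤ d) (hp : IsRadialDensity p)
    {κ₀ κ₁ : Icc (-1 : ℝ) 1 → ℝ} (hκ₀ : Measurable κ₀) (hκ₁ : Measurable κ₁) {C₀ C₁ : ℝ}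
    (hC₀ : ∀ t, |κ₀ t| ≤ C₀) (hC₁ : ∀ t, |κ₁ t| ≤ C₁) {lam mu : ℕ → ℝ}
    (hlam : ∀ k, ∀ Y ∈ sphericalHarmonics d k, ∀ ω : USphere d,
      ∫ η, κ₀ (sphereInner ω η) * Y η ∂(surfMeasure d) = lam k * Y ω)
    (hmu : ∀ k, ∀ Y ∈ sphericalHarmonics d k, ∀ ω : USphere d,
      ∫ η, κ₁ (sphereInner ω η) * Y η ∂(surfMeasure d) = mu k * Y ω)
    {Y : (k : ℕ) → Fin (numHarmonics d k) → USphere d → ℝ} (hY : IsHarmonicBasis d Y)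
    {c : ℝ} (hc : c ≠ 0) {F : USphere d × Ioi (0 : ℝ) → ℝ}
    (hF : MemLp F 2 ((surfMeasure d).prod (radialLaw d p)))
    (heig : ∀ᵐ q ∂((surfMeasure d).prod (radialLaw d p)),
      ∫ q' : USphere d × Ioi (0 : ℝ),
        (q.2 * q'.2 * κ₀ (sphereInner q.1 q'.1) + κ₁ (sphereInner q.1 q'.1)) * F q'
          ∂((surfMeasure d).prod (radialLaw d p)) = c * F q) :
    ∃ (K : Finset ℕ) (u : (k : ℕ) → Fin (numHarmonics d k) → Fin 2 → ℝ),
      (∀ k j, (momentAction d p (lam k) (mu k)).mulVec (u k j) = c • u k j) ∧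
      F =ᵐ[(surfMeasure d).prod (radialLaw d p)] fun q =>
        ∑ k ∈ K, ∑ j, (u k j 0 * q.2 + u k j 1) * Y k j q.1 := by
  have := isFiniteMeasure_radialLaw (d := d) hp
  set τ := (surfMeasure d).prod (radialLaw d p) with hτ
  obtain ⟨G, hGm, hFG⟩ : ∃ G, Measurable G ∧ F =ᵐ[τ] G :=
    ⟨hF.1.mk F, hF.1.stronglyMeasurable_mk.measurable, hF.1.ae_eq_mk⟩
  have hG2 : MemLp G 2 τ := (memLp_congr_ae hFG).1 hF
  have hG1 : Integrable G τ := hG2.integrable (by norm_num)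
  have hrG : Integrable (fun q : USphere d × Ioi (0 : ℝ) => (q.2 : ℝ) * G q) τ :=
    MemLp.integrable_mul ((memLp_radius hp).comp_snd (surfMeasure d)) hG2
  have hrGm : Measurable fun q : USphere d × Ioi (0 : ℝ) => (q.2 : ℝ) * G q := by fun_prop
  -- the eigenvalue equation divided by `c` reads `F = r g₁ + g₀`
  set T₀ := zonalTransform τ κ₀ fun q => (q.2 : ℝ) * G q with hT₀
  set T₁ := zonalTransform τ κ₁ G with hT₁
  set g₁ : USphere d → ℝ := fun ω => c⁻¹ * T₀ ω with hg₁
  set g₀ : USphere d → ℝ := fun ω => c⁻¹ * T₁ ω with hg₀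
  have hg₁m : Measurable g₁ := (measurable_zonalTransform hκ₀ hrGm).const_mul _
  have hg₀m : Measurable g₀ := (measurable_zonalTransform hκ₁ hGm).const_mul _
  obtain ⟨B₁, hB₁⟩ : ∃ B, ∀ ω, |g₁ ω| ≤ B := ⟨_, fun ω => by
    rw [hg₁, abs_mul]
    exact mul_le_mul_of_nonneg_left (abs_zonalTransform_le hC₀ hrG ω) (abs_nonneg _)⟩
  obtain ⟨B₀, hB₀⟩ : ∃ B, ∀ ω, |g₀ ω| ≤ B := ⟨_, fun ω => by
    rw [hg₀, abs_mul]
    exact mul_le_mul_of_nonneg_left (abs_zonalTransform_le hC₁ hG1 ω) (abs_nonneg _)⟩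
  have hrep : G =ᵐ[τ] fun q => q.2 * g₁ q.1 + g₀ q.1 := by
    filter_upwards [heig, hFG] with q hq hFq
    have h1 : ∫ q' : USphere d × Ioi (0 : ℝ),
        (q.2 * q'.2 * κ₀ (sphereInner q.1 q'.1) + κ₁ (sphereInner q.1 q'.1)) * F q' ∂τ =
        q.2 * T₀ q.1 + T₁ q.1 := by
      rw [hT₀, hT₁, zonalTransform, zonalTransform, ← integral_const_mul, ← integral_add
        ((integrable_zonal_mul_prod hκ₀ hC₀ hrG q.1).const_mul _)
        (integrable_zonal_mul_prod hκ₁ hC₁ hG1 q.1)]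
      refine integral_congr_ae ?_
      filter_upwards [hFG] with q' hq'
      rw [hq']
      ring
    rw [h1, hFq] at hq
    simp only [hg₁, hg₀]
    field_simp
    linarith
  have hgi : ∀ {g : USphere d → ℝ} (_ : Measurable g) {B : ℝ} (_ : ∀ ω, |g ω| ≤ B)
      {Z : USphere d → ℝ} (_ : Continuous Z), Integrable (fun ω => g ω * Z ω) (surfMeasure d) :=
    fun hg _ hB _ hZ => (integrable_of_continuous hZ).bdd_mul hg.aestronglyMeasurable
      (.of_forall hB)
  -- weighted coefficients of `G` in terms of the coefficients of `g₁` and `g₀`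
  have hcoef : ∀ {Z : USphere d → ℝ} (_ : Continuous Z) (a b : ℝ),
      ∫ q : USphere d × Ioi (0 : ℝ), (a * q.2 + b) * G q * Z q.1 ∂τ =
        a * (radialMoment d p 2 * (∫ ω, g₁ ω * Z ω ∂(surfMeasure d)) +
          radialMoment d p 1 * ∫ ω, g₀ ω * Z ω ∂(surfMeasure d)) +
        b * (radialMoment d p 1 * (∫ ω, g₁ ω * Z ω ∂(surfMeasure d)) +
          radialMoment d p 0 * ∫ ω, g₀ ω * Z ω ∂(surfMeasure d)) := by
    intro Z hZ a b
    have e : ∫ q : USphere d × Ioi (0 : ℝ), (a * q.2 + b) * G q * Z q.1 ∂τ =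
        ∫ q : USphere d × Ioi (0 : ℝ), ((g₁ q.1 * Z q.1) * ((a * q.2 + b) * (1 * q.2 + 0)) +
          (g₀ q.1 * Z q.1) * (a * q.2 + b)) ∂τ := by
      refine integral_congr_ae ?_
      filter_upwards [hrep] with q hq
      rw [hq]
      ring
    rw [e, hτ, integral_add
        ((hgi hg₁m hB₁ hZ).mul_prod (integrable_affine_mul_affine hp a b 1 0))
        ((hgi hg₀m hB₀ hZ).mul_prod (integrable_affine hp a b)),
      integral_prod_mul (fun ω => g₁ ω * Z ω)
        fun r : Ioi (0 : ℝ) => (a * (r : ℝ) + b) * (1 * (r : ℝ) + 0),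
      integral_prod_mul (fun ω => g₀ ω * Z ω) fun r : Ioi (0 : ℝ) => a * (r : ℝ) + b,
      integral_affine_mul_affine hd hp, integral_affine hd hp]
    ring
  have hYm := harmonicBasis_mem hY
  set u : (k : ℕ) → Fin (numHarmonics d k) → Fin 2 → ℝ := fun k j =>
    ![∫ ω, g₁ ω * Y k j ω ∂(surfMeasure d), ∫ ω, g₀ ω * Y k j ω ∂(surfMeasure d)] with hu
  have hBu : ∀ k j, (momentAction d p (lam k) (mu k)).mulVec (u k j) = c • u k j := by
    intro k j
    have hZ := continuous_sphericalHarmonic (hYm k j)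
    have h1 := integral_zonalTransform_mul hκ₀ hC₀ hrG hZ (hlam k _ (hYm k j))
    have h0 := integral_zonalTransform_mul hκ₁ hC₁ hG1 hZ (hmu k _ (hYm k j))
    have c1 := hcoef hZ 1 0
    have c0 := hcoef hZ 0 1
    simp only [one_mul, zero_mul, add_zero, zero_add] at c1 c0
    rw [c1] at h1
    rw [c0] at h0
    rw [momentAction_mulVec]
    have s1 : c * ∫ ω, g₁ ω * Y k j ω ∂(surfMeasure d) =
        ∫ ω, T₀ ω * Y k j ω ∂(surfMeasure d) := by
      rw [← integral_const_mul]
      congr 1 with ω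
      simp only [hg₁]
      field_simp
    have s0 : c * ∫ ω, g₀ ω * Y k j ω ∂(surfMeasure d) =
        ∫ ω, T₁ ω * Y k j ω ∂(surfMeasure d) := by
      rw [← integral_const_mul]
      congr 1 with ω
      simp only [hg₀]
      field_simp
    ext i
    fin_cases i
    · simpa [hu, s1] using h1.symm
    · simpa [hu, s0] using h0.symm
  have hfin : {k | ∃ j, u k j ≠ 0}.Finite := by
    set ε := |c| / (1 + |radialMoment d p 2| + 2 * |radialMoment d p 1| + |radialMoment d p 0|)
    have hε : 0 < ε := div_pos (abs_pos.2 hc) (by positivity)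
    refine ((finite_setOf_le_abs_funkHecke hd hκ₀ hC₀ hlam hε).union
      (finite_setOf_le_abs_funkHecke hd hκ₁ hC₁ hmu hε)).subset ?_
    rintro k ⟨j, hj⟩
    have hZ : ∃ Z ∈ sphericalHarmonics d k, ∫ ω, Z ω * Z ω ∂(surfMeasure d) = 1 :=
      ⟨Y k j, hYm k j, by simpa using hY.orthonormal k j j⟩
    by_contra hk
    simp only [mem_union, mem_ofPred_eq, hZ, true_and, not_or, not_le] at hk
    exact hj (eq_zero_of_momentAction_mulVec_eq hc hk.1 hk.2 (hBu k j))
  have hK : ∀ k ∉ hfin.toFinset, ∀ j, u k j = 0 := by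
    intro k hk j
    by_contra h
    exact hk (hfin.mem_toFinset.2 ⟨j, h⟩)
  refine ⟨hfin.toFinset, u, hBu, ?_⟩
  have ex₁ := ae_eq_sum_harmonics hd hY hg₁m hB₁ hfin.toFinset fun k hk j => by
    simpa [hu] using congrFun (hK k hk j) 0
  have ex₀ := ae_eq_sum_harmonics hd hY hg₀m hB₀ hfin.toFinset fun k hk j => by
    simpa [hu] using congrFun (hK k hk j) 1
  have ey₁ := Measure.quasiMeasurePreserving_fst (ν := radialLaw d p) |>.ae ex₁
  have ey₀ := Measure.quasiMeasurePreserving_fst (ν := radialLaw d p) |>.ae ex₀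
  filter_upwards [hFG, hrep, ey₁, ey₀] with q h1 h2 h3 h4
  rw [h1, h2, h3, h4, Finset.mul_sum, ← Finset.sum_add_distrib]
  refine Finset.sum_congr rfl fun k _ => ?_
  rw [Finset.mul_sum, ← Finset.sum_add_distrib]
  refine Finset.sum_congr rfl fun j _ => ?_
  simp only [hu, Matrix.cons_val_zero, Matrix.cons_val_one]
  ring

end Expansion

/-! ### Diagonalization of the moment matrices -/

section Diagonalization

open Matrix

/-- For `M = Lᵀ L` with `L` invertible and `D` symmetric, the matrix `D M` has an `M`-orthonormal
basis of eigenvectors: they are the images under `L⁻¹` of eigenvectors of `L D Lᵀ`. Each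
eigenspace is spanned by the basis vectors it contains. -/
lemma exists_orthonormal_eigenbasis_mul {n : Type*} [Fintype n] [DecidableEq n]
    {L D : Matrix n n ℝ} (hL : IsUnit L.det) (hD : D.IsHermitian) :
    ∃ (v : n → n → ℝ) (ρ : n → ℝ), (∀ s, (D * (Lᵀ * L)) *ᵥ v s = ρ s • v s) ∧
      (∀ s t, v s ⬝ᵥ (Lᵀ * L) *ᵥ v t = if s = t then 1 else 0) ∧
      ∀ (c : ℝ) (u : n → ℝ), (D * (Lᵀ * L)) *ᵥ u = c • u →
        ∃ a : n → ℝ, u = ∑ s, a s • v s ∧ ∀ s, ρ s = c ∨ a s = 0 := by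
  have hA : (L * D * Lᵀ).IsHermitian := by
    simpa using isHermitian_mul_mul_conjTranspose L hD
  set w : n → n → ℝ := fun s => ⇑(hA.eigenvectorBasis s) with hw
  have hLw : ∀ s, L *ᵥ (L⁻¹ *ᵥ w s) = w s := fun s => by
    rw [mulVec_mulVec, mul_nonsing_inv _ hL, one_mulVec]
  have heig : ∀ s, (D * (Lᵀ * L)) *ᵥ (L⁻¹ *ᵥ w s) = hA.eigenvalues s • (L⁻¹ *ᵥ w s) := fun s => by
    have h : (L * D * Lᵀ) *ᵥ w s = hA.eigenvalues s • w s := hA.mulVec_eigenvectorBasis s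
    have h2 := congrArg (fun x => L⁻¹ *ᵥ x) h
    simp only [mulVec_mulVec, mulVec_smul] at h2
    rw [← h2, mulVec_mulVec]
    congr 1
    rw [mul_assoc L D, nonsing_inv_mul_cancel_left _ _ hL, mul_assoc, mul_assoc,
      mul_nonsing_inv _ hL, mul_one]
  have horth : ∀ s t, (L⁻¹ *ᵥ w s) ⬝ᵥ (Lᵀ * L) *ᵥ (L⁻¹ *ᵥ w t) = if s = t then 1 else 0 := by
    intro s t
    rw [← mulVec_mulVec, hLw, dotProduct_mulVec, vecMul_transpose, hLw]
    have h := orthonormal_iff_ite.1 hA.eigenvectorBasis.orthonormal t s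
    simpa [hw, PiLp.inner_apply, dotProduct, eq_comm] using h
  have hspan : ∀ u : n → ℝ, ∃ a : n → ℝ, u = ∑ s, a s • (L⁻¹ *ᵥ w s) := fun u => by
    refine ⟨fun s => hA.eigenvectorBasis.repr (WithLp.toLp 2 (L *ᵥ u)) s, ?_⟩
    have h := hA.eigenvectorBasis.sum_repr (WithLp.toLp 2 (L *ᵥ u))
    have h2 : L *ᵥ u = ∑ s, hA.eigenvectorBasis.repr (WithLp.toLp 2 (L *ᵥ u)) s • w s := by
      have := congrArg (WithLp.ofLp) h
      simpa [hw] using this.symm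
    calc u = L⁻¹ *ᵥ (L *ᵥ u) := by rw [mulVec_mulVec, nonsing_inv_mul _ hL, one_mulVec]
      _ = _ := by
        conv_lhs => rw [h2]
        simp only [mulVec_sum, mulVec_smul]
  refine ⟨fun s => L⁻¹ *ᵥ w s, hA.eigenvalues, heig, horth, fun c u hu => ?_⟩
  obtain ⟨a, ha⟩ := hspan u
  refine ⟨a, ha, fun t => ?_⟩
  have h0 : ∑ s, (a s * (hA.eigenvalues s - c)) • (L⁻¹ *ᵥ w s) = 0 := by
    rw [ha, mulVec_sum, Finset.smul_sum, ← sub_eq_zero, ← Finset.sum_sub_distrib] at hu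
    rw [← hu]
    refine Finset.sum_congr rfl fun s _ => ?_
    rw [mulVec_smul, heig]
    module
  have h1 := congrArg (fun x => (L⁻¹ *ᵥ w t) ⬝ᵥ (Lᵀ * L) *ᵥ x) h0
  simp only [mulVec_sum, mulVec_smul, dotProduct_sum, dotProduct_smul, horth, mulVec_zero,
    dotProduct_zero, smul_eq_mul, mul_ite, mul_one, mul_zero, Finset.sum_ite_eq,
    Finset.mem_univ, if_true] at h1
  exact (mul_eq_zero.1 h1).symm.imp_left sub_eq_zero.1

variable {d : ℕ} {p : ℝ → ℝ}

lemma exists_momentAction_eigenbasis (hd : 1 ≤ d) (hp : IsRadialDensity p) (l m : ℝ) :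
    ∃ (v : Fin 2 → Fin 2 → ℝ) (ρ : Fin 2 → ℝ),
      (∀ s, (momentAction d p l m).mulVec (v s) = ρ s • v s) ∧
      (∀ s t, v s 0 * (radialMoment d p 2 * v t 0 + radialMoment d p 1 * v t 1) +
        v s 1 * (radialMoment d p 1 * v t 0 + radialMoment d p 0 * v t 1) =
          if s = t then 1 else 0) ∧
      ∀ (c : ℝ) (u : Fin 2 → ℝ), (momentAction d p l m).mulVec u = c • u →
        ∃ a : Fin 2 → ℝ, u = ∑ s, a s • v s ∧ ∀ s, ρ s = c ∨ a s = 0 := by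
  set M₂ := radialMoment d p 2 with hM₂
  set M₁ := radialMoment d p 1 with hM₁
  set M₀ := radialMoment d p 0 with hM₀
  have h2 : 0 < M₂ := by simpa using momentForm_pos hd hp (a := 1) (b := 0) (by simp)
  have hdet : 0 < M₀ - M₁ ^ 2 / M₂ := by
    -- the moment form at `r ↦ 1 - (M₁ / M₂) r` is the Schur complement
    have := momentForm_pos hd hp (a := -M₁ / M₂) (b := 1) (by simp)
    rw [← hM₂, ← hM₁, ← hM₀] at this
    have e : -M₁ / M₂ * (M₂ * (-M₁ / M₂) + M₁ * 1) + 1 * (M₁ * (-M₁ / M₂) + M₀ * 1) =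
        M₀ - M₁ ^ 2 / M₂ := by field_simp; ring
    rwa [e] at this
  -- the Cholesky factor of the moment matrix
  set L : Matrix (Fin 2) (Fin 2) ℝ := !![√M₂, M₁ / √M₂; 0, √(M₀ - M₁ ^ 2 / M₂)] with hL
  have hs : √M₂ ≠ 0 := (Real.sqrt_pos.2 h2).ne'
  have hLL : Lᵀ * L = !![M₂, M₁; M₁, M₀] := by
    have q1 := Real.mul_self_sqrt h2.le
    have q2 := Real.mul_self_sqrt hdet.le
    have q3 : M₁ / √M₂ * (M₁ / √M₂) = M₁ ^ 2 / M₂ := by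
      rw [div_mul_div_comm, q1, sq]
    ext i j
    fin_cases i <;> fin_cases j <;> simp [hL, Matrix.mul_apply, Fin.sum_univ_two, q1, q2, q3] <;>
      field_simp
  have hu : IsUnit L.det := by
    rw [hL, det_fin_two_of, isUnit_iff_ne_zero]
    simpa [h2.le] using ⟨h2.ne', (Real.sqrt_pos.2 hdet).ne'⟩
  have hD : (!![l, 0; 0, m] : Matrix (Fin 2) (Fin 2) ℝ).IsHermitian := by
    ext i j
    fin_cases i <;> fin_cases j <;> simp
  obtain ⟨v, ρ, h1, h2, h3⟩ := exists_orthonormal_eigenbasis_mul hu hD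
  rw [hLL] at h1 h2 h3
  refine ⟨v, ρ, h1, fun s t => ?_, h3⟩
  rw [← h2 s t]
  simp [mulVec, dotProduct, Fin.sum_univ_two]

end Diagonalization

/-! ### Eigenfunctions of homogeneous kernels -/

section Kernels

variable {d : ℕ} {p : ℝ → ℝ} {k₀ k₁ : Eucl d → Eucl d → ℝ} {κ₀ κ₁ : ℝ → ℝ} {lam mu : ℕ → ℝ}

lemma ae_radialMeasure_iff (hd : 1 ≤ d) (hp : IsRadialDensity p) {Q : Eucl d → Prop} :
    (∀ᵐ x ∂(radialMeasure d p), Q x) ↔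
      ∀ᵐ q ∂((surfMeasure d).prod (radialLaw d p)), Q (polarMap d q) := by
  rw [radialMeasure_eq_map_polarMap hd hp, measurableEmbedding_polarMap.ae_map_iff]

lemma affineHarmonic_smul (c : ℝ) (v : Fin 2 → ℝ) (Y : USphere d → ℝ) :
    affineHarmonic (c • v) Y = c • affineHarmonic v Y := by
  ext x
  by_cases hx : x = 0 <;> simp [affineHarmonic, hx]
  ring

lemma affineHarmonic_add (v w : Fin 2 → ℝ) (Y : USphere d → ℝ) :
    affineHarmonic (v + w) Y = affineHarmonic v Y + affineHarmonic w Y := by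
  ext x
  by_cases hx : x = 0 <;> simp [affineHarmonic, hx]
  ring

/-- The Funk–Hecke formula for the profile of a homogeneous kernel. -/
theorem exists_hasSphereEigenvalues (hd : 1 ≤ d) {α : ℝ} {k : Eucl d → Eucl d → ℝ} {κ : ℝ → ℝ}
    (hk : IsHomogeneousKernel α k κ) : ∃ lam : ℕ → ℝ, HasSphereEigenvalues d κ lam := by
  obtain ⟨C, hC⟩ := hk.bounded
  have hC' : ∀ t : Icc (-1 : ℝ) 1, |κ t| ≤ C := fun t => hC t t.2
  choose lam hlam using exists_funkHecke hd hk.measurable hC'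
  exact ⟨lam, fun k Y hY ω => ⟨integrable_zonal_mul hk.measurable hC' ω
    (continuous_sphericalHarmonic hY), hlam k Y hY ω⟩⟩

/-- The sum of the kernels acts on `(α r + β) Y` through the matrix `momentAction`. -/
theorem integral_kernel_mul_affineHarmonic (hd : 1 ≤ d) (hp : IsRadialDensity p)
    (hk₀ : IsHomogeneousKernel 1 k₀ κ₀) (hk₁ : IsHomogeneousKernel 0 k₁ κ₁)
    (hlam : HasSphereEigenvalues d κ₀ lam) (hmu : HasSphereEigenvalues d κ₁ mu) {k : ℕ}
    {Y : USphere d → ℝ} (hY : Y ∈ sphericalHarmonics d k) (v : Fin 2 → ℝ) {x : Eucl d}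
    (hx : x ≠ 0) :
    Integrable (fun z => (k₀ x z + k₁ x z) * affineHarmonic v Y z) (radialMeasure d p) ∧
    ∫ z, (k₀ x z + k₁ x z) * affineHarmonic v Y z ∂(radialMeasure d p) =
      affineHarmonic ((momentAction d p (lam k) (mu k)).mulVec v) Y x := by
  obtain ⟨q, rfl⟩ := exists_polarMap_eq hx
  obtain ⟨C₀, hC₀⟩ := hk₀.bounded
  obtain ⟨C₁, hC₁⟩ := hk₁.bounded
  have h := integral_polarKernel_mul_affine hd hp hk₀.measurable hk₁.measurable
    (fun t => hC₀ t t.2) (fun t => hC₁ t t.2) (continuous_sphericalHarmonic hY)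
    (fun ω => (hlam k Y hY ω).2) (fun ω => (hmu k Y hY ω).2) v q
  have e : ∀ q', (k₀ (polarMap d q) (polarMap d q') + k₁ (polarMap d q) (polarMap d q')) *
      affineHarmonic v Y (polarMap d q') =
      (q.2 * q'.2 * κ₀ (sphereInner q.1 q'.1) + κ₁ (sphereInner q.1 q'.1)) *
        ((v 0 * q'.2 + v 1) * Y q'.1) := fun q' => by
    rw [kernel_polarMap hk₀ hk₁, affineHarmonic_polarMap]
  rw [radialMeasure_eq_map_polarMap hd hp, measurableEmbedding_polarMap.integral_map,
    measurableEmbedding_polarMap.integrable_map_iff, affineHarmonic_polarMap]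
  refine ⟨h.1.congr (.of_forall fun q' => (e q').symm), ?_⟩
  simp_rw [e]
  exact h.2

/-- Eigenvectors of `momentAction` give eigenfunctions of the sum of the kernels. -/
theorem isKernelEigenfunction_affineHarmonic (hd : 1 ≤ d) (hp : IsRadialDensity p)
    (hk₀ : IsHomogeneousKernel 1 k₀ κ₀) (hk₁ : IsHomogeneousKernel 0 k₁ κ₁)
    (hlam : HasSphereEigenvalues d κ₀ lam) (hmu : HasSphereEigenvalues d κ₁ mu) {k : ℕ}
    {Y : USphere d → ℝ} (hY : Y ∈ sphericalHarmonics d k) {v : Fin 2 → ℝ} {ρ : ℝ}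
    (hv : (momentAction d p (lam k) (mu k)).mulVec v = ρ • v)
    (hnorm : ∫ x, affineHarmonic v Y x * affineHarmonic v Y x ∂(radialMeasure d p) ≠ 0) :
    IsKernelEigenfunction (radialMeasure d p) (fun x z => k₀ x z + k₁ x z) ρ
      (affineHarmonic v Y) where
  memLp := memLp_affineHarmonic hd hp v (continuous_sphericalHarmonic hY)
  ne_zero h0 := by
    refine hnorm ?_
    rw [integral_congr_ae (g := fun _ => (0 : ℝ)), integral_zero]
    filter_upwards [h0] with x hx
    simp [hx]
  eigen := by
    refine (ae_radialMeasure_iff hd hp).2 (.of_forall fun q => ?_)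
    have h := integral_kernel_mul_affineHarmonic hd hp hk₀ hk₁ hlam hmu hY v (polarMap_ne_zero q)
    rw [hv, affineHarmonic_smul] at h
    exact h

/-- An eigenfunction of the sum of the kernels with a nonzero eigenvalue is a finite sum of
functions `(α r + β) Y` with `(α, β)` in the corresponding eigenspace of `momentAction`. -/
theorem eigenfunction_ae_eq_sum (hd : 1 ≤ d) (hp : IsRadialDensity p)
    (hk₀ : IsHomogeneousKernel 1 k₀ κ₀) (hk₁ : IsHomogeneousKernel 0 k₁ κ₁)
    (hlam : HasSphereEigenvalues d κ₀ lam) (hmu : HasSphereEigenvalues d κ₁ mu)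
    {Y : (k : ℕ) → Fin (numHarmonics d k) → USphere d → ℝ} (hY : IsHarmonicBasis d Y)
    {c : ℝ} (hc : c ≠ 0) {f : Eucl d → ℝ}
    (hf : IsKernelEigenfunction (radialMeasure d p) (fun x z => k₀ x z + k₁ x z) c f) :
    ∃ (K : Finset ℕ) (u : (k : ℕ) → Fin (numHarmonics d k) → Fin 2 → ℝ),
      (∀ k j, (momentAction d p (lam k) (mu k)).mulVec (u k j) = c • u k j) ∧
      f =ᵐ[radialMeasure d p] ∑ k ∈ K, ∑ j, affineHarmonic (u k j) (Y k j) := by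
  obtain ⟨C₀, hC₀⟩ := hk₀.bounded
  obtain ⟨C₁, hC₁⟩ := hk₁.bounded
  have hF : MemLp (f ∘ polarMap d) 2 ((surfMeasure d).prod (radialLaw d p)) := by
    have := hf.memLp
    rwa [radialMeasure_eq_map_polarMap hd hp,
      measurableEmbedding_polarMap.memLp_map_measure_iff] at this
  obtain ⟨K, u, hu, hFu⟩ := polar_eigenfunction_ae_eq_sum hd hp hk₀.measurable hk₁.measurable
    (fun t => hC₀ t t.2) (fun t => hC₁ t t.2) (fun k Z hZ ω => (hlam k Z hZ ω).2)
    (fun k Z hZ ω => (hmu k Z hZ ω).2) hY hc hF (by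
      filter_upwards [(ae_radialMeasure_iff hd hp).1 hf.eigen] with q hq
      have h := hq.2
      rw [radialMeasure_eq_map_polarMap hd hp, measurableEmbedding_polarMap.integral_map] at h
      simp_rw [kernel_polarMap hk₀ hk₁] at h
      exact h)
  refine ⟨K, u, hu, (ae_radialMeasure_iff hd hp).2 ?_⟩
  filter_upwards [hFu] with q hq
  simp only [Finset.sum_apply, affineHarmonic_polarMap]
  exact hq

end Kernels

theorem mainTheorem4 (d : ℕ) (hd : 1 ≤ d) (p : ℝ → ℝ) (hp : IsRadialDensity p)
    (k₀ k₁ : Eucl d → Eucl d → ℝ) (κ₀ κ₁ : ℝ → ℝ)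
    (hk₀ : IsHomogeneousKernel 1 k₀ κ₀) (hk₁ : IsHomogeneousKernel 0 k₁ κ₁) :
    ∃ lam mu : ℕ → ℝ, HasSphereEigenvalues d κ₀ lam ∧ HasSphereEigenvalues d κ₁ mu ∧
      -- the kernel of order 1
      ((∀ k, ∀ Y ∈ sphericalHarmonics d k, ∀ (a : ℝ) (x : Eucl d), x ≠ 0 →
          Integrable (fun z => k₀ x z * affineHarmonic ![a, 0] Y z) (radialMeasure d p) ∧
          ∫ z, k₀ x z * affineHarmonic ![a, 0] Y z ∂(radialMeasure d p) =
            (radialMoment d p 2 * lam k) * affineHarmonic ![a, 0] Y x) ∧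
        0 < radialMoment d p 2 ∧
        ∀ Y : (k : ℕ) → Fin (numHarmonics d k) → USphere d → ℝ, IsHarmonicBasis d Y →
          ∀ a : ℝ, a ^ 2 = (radialMoment d p 2)⁻¹ →
            IsOrthonormalSystem (radialMeasure d p)
              (fun i : (Σ k, Fin (numHarmonics d k)) => affineHarmonic ![a, 0] (Y i.1 i.2)) ∧
            (∀ k j, IsKernelEigenfunction (radialMeasure d p) k₀ (radialMoment d p 2 * lam k)
              (affineHarmonic ![a, 0] (Y k j))) ∧
            ∀ (c : ℝ) (f : Eucl d → ℝ), c ≠ 0 →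
              IsKernelEigenfunction (radialMeasure d p) k₀ c f →
              ∃ g ∈ Submodule.span ℝ {Ψ : Eucl d → ℝ | ∃ k j, radialMoment d p 2 * lam k = c ∧
                  Ψ = affineHarmonic ![a, 0] (Y k j)},
                f =ᵐ[radialMeasure d p] g) ∧
      -- the sum of a kernel of order 1 and a kernel of order 0
      ((∀ k, ∀ Y ∈ sphericalHarmonics d k, ∀ (v : Fin 2 → ℝ) (x : Eucl d), x ≠ 0 →
          Integrable (fun z => (k₀ x z + k₁ x z) * affineHarmonic v Y z) (radialMeasure d p) ∧
          ∫ z, (k₀ x z + k₁ x z) * affineHarmonic v Y z ∂(radialMeasure d p) =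
            affineHarmonic ((momentAction d p (lam k) (mu k)).mulVec v) Y x) ∧
        ∃ (v : ℕ → Fin 2 → Fin 2 → ℝ) (ρ : ℕ → Fin 2 → ℝ),
          (∀ k s, (momentAction d p (lam k) (mu k)).mulVec (v k s) = ρ k s • v k s) ∧
          ∀ Y : (k : ℕ) → Fin (numHarmonics d k) → USphere d → ℝ, IsHarmonicBasis d Y →
            IsOrthonormalSystem (radialMeasure d p)
              (fun i : (Σ k, Fin (numHarmonics d k)) × Fin 2 =>
                affineHarmonic (v i.1.1 i.2) (Y i.1.1 i.1.2)) ∧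
            (∀ k j s, IsKernelEigenfunction (radialMeasure d p) (fun x z => k₀ x z + k₁ x z)
              (ρ k s) (affineHarmonic (v k s) (Y k j))) ∧
            ∀ (c : ℝ) (f : Eucl d → ℝ), c ≠ 0 →
              IsKernelEigenfunction (radialMeasure d p) (fun x z => k₀ x z + k₁ x z) c f →
              ∃ g ∈ Submodule.span ℝ {Ψ : Eucl d → ℝ | ∃ k j s, ρ k s = c ∧
                  Ψ = affineHarmonic (v k s) (Y k j)},
                f =ᵐ[radialMeasure d p] g) := by
  obtain ⟨lam, hlam⟩ := exists_hasSphereEigenvalues hd hk₀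
  obtain ⟨mu, hmu⟩ := exists_hasSphereEigenvalues hd hk₁
  have hM₂ : 0 < radialMoment d p 2 := by
    simpa using momentForm_pos hd hp (a := 1) (b := 0) (by simp)
  -- the kernel of order 1 is its sum with the zero kernel of order 0
  have hzero : IsHomogeneousKernel 0 (fun _ _ : Eucl d => 0) fun _ => 0 :=
    ⟨measurable_const, ⟨0, fun _ _ => by simp⟩, fun _ _ _ _ => by simp⟩
  have hmu₀ : HasSphereEigenvalues d (fun _ => 0) fun _ => 0 := fun k Y _ ω => by simp
  have hB : ∀ k (a : ℝ), (momentAction d p (lam k) 0).mulVec ![a, 0] =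
      (radialMoment d p 2 * lam k) • ![a, 0] := fun k a => by
    rw [momentAction_mulVec]
    ext i
    fin_cases i <;> simp; ring
  refine ⟨lam, mu, hlam, hmu, ⟨?_, hM₂, ?_⟩, fun k Y hY v x hx =>
    integral_kernel_mul_affineHarmonic hd hp hk₀ hk₁ hlam hmu hY v hx, ?_⟩
  · intro k Y hY a x hx
    have h := integral_kernel_mul_affineHarmonic hd hp hk₀ hzero hlam hmu₀ hY ![a, 0] hx
    rw [hB, affineHarmonic_smul, Pi.smul_apply, smul_eq_mul] at h
    simpa only [add_zero] using h
  · intro Y hY a ha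
    have hmem := harmonicBasis_mem hY
    have ha0 : a ≠ 0 := fun h => (inv_pos.2 hM₂).ne' (by rw [← ha, h]; simp)
    have hin : ∀ k j l i, ∫ x, affineHarmonic ![a, 0] (Y k j) x * affineHarmonic ![a, 0] (Y l i) x
        ∂(radialMeasure d p) = ∫ ω, Y k j ω * Y l i ω ∂(surfMeasure d) := fun k j l i => by
      have : a * (radialMoment d p 2 * a) = 1 := by
        rw [mul_left_comm, ← sq, ha, mul_inv_cancel₀ hM₂.ne']
      rw [integral_affineHarmonic_mul hd hp]
      simp [this]
    have hone : ∀ k j, ∫ x, affineHarmonic ![a, 0] (Y k j) x * affineHarmonic ![a, 0] (Y k j) x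
        ∂(radialMeasure d p) = 1 := fun k j => by rw [hin, hY.orthonormal, if_pos rfl]
    refine ⟨⟨fun i => memLp_affineHarmonic hd hp _ (continuous_sphericalHarmonic (hmem _ _)),
      fun i => hone _ _, ?_⟩, fun k j => ?_, fun c f hc hf => ?_⟩
    · rintro ⟨k, j⟩ ⟨l, i⟩ hne
      rw [hin]
      by_cases hkl : k = l
      · subst hkl
        rw [hY.orthonormal, if_neg fun h : j = i => hne (by rw [h])]
      · exact integral_sphericalHarmonics_mul_eq_zero hd hkl (hmem k j) (hmem l i)
    · have h := isKernelEigenfunction_affineHarmonic hd hp hk₀ hzero hlam hmu₀ (hmem k j) (hB k a)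
        (by rw [hone]; exact one_ne_zero)
      simpa only [add_zero] using h
    · obtain ⟨K, u, hu, hfu⟩ := eigenfunction_ae_eq_sum hd hp hk₀ hzero hlam hmu₀ hY hc
        (f := f) (by simpa only [add_zero] using hf)
      refine ⟨_, Submodule.sum_mem _ fun k _ => Submodule.sum_mem _ fun j _ => ?_, hfu⟩
      have h := hu k j
      rw [momentAction_mulVec] at h
      have h0 : lam k * (radialMoment d p 2 * u k j 0 + radialMoment d p 1 * u k j 1) =
          c * u k j 0 := by simpa using congrFun h 0
      have h1 : u k j 1 = 0 := by simpa [hc] using congrFun h 1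
      have hu0 : u k j = (u k j 0 / a) • ![a, 0] := by
        ext i
        fin_cases i <;> simp [h1, ha0]
      rw [hu0, affineHarmonic_smul]
      by_cases hk : radialMoment d p 2 * lam k = c
      · exact Submodule.smul_mem _ _ (Submodule.subset_span ⟨k, j, hk, rfl⟩)
      · have : (radialMoment d p 2 * lam k - c) * u k j 0 = 0 := by
          rw [h1] at h0
          linarith
        rw [(mul_eq_zero.1 this).resolve_left (sub_ne_zero.2 hk), zero_div, zero_smul]
        exact Submodule.zero_mem _
  · choose v ρ hv horth hspan using fun k =>
      exists_momentAction_eigenbasis hd hp (lam k) (mu k)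
    refine ⟨v, ρ, hv, fun Y hY => ?_⟩
    have hmem := harmonicBasis_mem hY
    have hone : ∀ k j s, ∫ x, affineHarmonic (v k s) (Y k j) x * affineHarmonic (v k s) (Y k j) x
        ∂(radialMeasure d p) = 1 := fun k j s => by
      rw [integral_affineHarmonic_mul hd hp, horth, hY.orthonormal]; simp
    refine ⟨⟨fun i => memLp_affineHarmonic hd hp _ (continuous_sphericalHarmonic (hmem _ _)),
      fun i => hone _ _ _, ?_⟩, fun k j s => isKernelEigenfunction_affineHarmonic hd hp hk₀ hk₁
        hlam hmu (hmem k j) (hv k s) (by rw [hone]; exact one_ne_zero), fun c f hc hf => ?_⟩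
    · rintro ⟨⟨k, j⟩, s⟩ ⟨⟨l, i⟩, t⟩ hne
      rw [integral_affineHarmonic_mul hd hp]
      by_cases hkl : k = l
      · subst hkl
        by_cases hji : j = i
        · subst hji
          have hst : s ≠ t := fun h => hne (by rw [h])
          rw [horth, if_neg hst, zero_mul]
        · rw [hY.orthonormal, if_neg hji, mul_zero]
      · rw [integral_sphericalHarmonics_mul_eq_zero hd hkl (hmem k j) (hmem l i), mul_zero]
    · obtain ⟨K, u, hu, hfu⟩ := eigenfunction_ae_eq_sum hd hp hk₀ hk₁ hlam hmu hY hc hf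
      refine ⟨_, Submodule.sum_mem _ fun k _ => Submodule.sum_mem _ fun j _ => ?_, hfu⟩
      obtain ⟨a, ha, hcoef⟩ := hspan k c (u k j) (hu k j)
      rw [ha, Fin.sum_univ_two, affineHarmonic_add, affineHarmonic_smul, affineHarmonic_smul]
      have hterm : ∀ t, a t • affineHarmonic (v k t) (Y k j) ∈
          Submodule.span ℝ {Ψ : Eucl d → ℝ | ∃ k j s, ρ k s = c ∧
            Ψ = affineHarmonic (v k s) (Y k j)} := fun t => by
        rcases hcoef t with h | h
        · exact Submodule.smul_mem _ _ (Submodule.subset_span ⟨k, j, t, h, rfl⟩)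
        · rw [h, zero_smul]; exact Submodule.zero_mem _
      exact Submodule.add_mem _ (hterm 0) (hterm 1)
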